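/- There is a function $\kappa:(0,\infty)\to(0,\infty)$, with $\kappa(\rho)\sim c\,\rho^{-1}$ as $\rho\to\infty$ for some constant $c>0$, such that the following holds. Let $f$ be an entire function of finite positive order $\rho$, that is, $\limsup_{r\to\infty}\frac{\log\log M(r,f)}{\log r}=\rho\in(0,\infty)$, where $M(r,f)=\max_{|z|\le r}|f(z)|$. Then there are arbitrarily large $r>0$ such that, for every sector $S=\{w\colon 0<|w|<\infty,\ \theta_1<\arg w<\theta_2\}$ of opening $\alpha=\theta_2-\theta_1\in(0,2\pi]$, \[ A(r,S,f):=\frac{\operatorname{Area}\bigl(f^{-1}S\cap\{|z|<r\}\bigr)}{\operatorname{Area}\bigl(\{|z|<r\}\bigr)}\ \ge\ \frac{\alpha\,\kappa(\rho)}{2\pi}. \] The value of $r$ may depend on $f$ but not on $S$. -/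

import Mathlib

open MeasureTheory Filter Topology
open scoped Asymptotics

noncomputable section

/-- The maximum modulus `M(r, f) = max {|f z| : |z| ≤ r}` (attained for `f` entire and `r ≥ 0`). -/
def maxModulus (f : ℂ → ℂ) (r : ℝ) : ℝ :=
  sSup ((fun z => ‖f z‖) '' Metric.closedBall (0 : ℂ) r)

/-- The order of an entire function, `limsup_{r → ∞} log log M(r, f) / log r`, as an extended real
number. -/
def growthOrder (f : ℂ → ℂ) : EReal :=
  limsup (fun r : ℝ => ((Real.log (Real.log (maxModulus f r)) / Real.log r : ℝ) : EReal)) atTop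

/-- The open sector `{w : 0 < |w| < ∞, θ₁ < arg w < θ₂}` with vertex `0`; some value of the
multivalued argument of `w` lies in `(θ₁, θ₂)`. Its opening is `θ₂ - θ₁` when this is at
most `2π`. -/
def sector (θ₁ θ₂ : ℝ) : Set ℂ :=
  {w | ∃ t θ : ℝ, 0 < t ∧ θ₁ < θ ∧ θ < θ₂ ∧ w = t * Complex.exp (θ * Complex.I)}

/-- `A(r, S, f) = Area(f⁻¹S ∩ r𝔻) / Area(r𝔻)`, where `r𝔻 = {z : |z| < r}`. -/
def relArea (r : ℝ) (S : Set ℂ) (f : ℂ → ℂ) : ℝ :=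
  volume.real (f ⁻¹' S ∩ Metric.ball (0 : ℂ) r) / volume.real (Metric.ball (0 : ℂ) r)

end

/-! By the three circles theorem `φ x = log M(e^x, f)` is convex and increasing. Take an integer `N`
comparable to `1 + ρ` and the increments of `φ` over intervals of length `1 / N`. They increase to
infinity, and finite order forbids growth by a factor above `e^(3N)` over every long window of `N`
steps. So there are arbitrarily far windows in which at least half the steps multiply the increment
by at most `e^6`.

For such a step choose a maximum point `z` of `|f|` on the circle in question and rescale: `g w = f
(z + z w / N) / f z`. With `A` the increment to the left, `g 0 = 1`, `|g| ≤ exp (e^6 A)` on the unit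
disc and `|g (-t)| ≤ exp (-A t)`. The local estimate `volume_preimage_sector_unit_disc_ge` says that
`g⁻¹S` then has area at least a constant times `α` in a fixed disc. Undoing the scaling gives about
`N / 2` disjoint discs, each contributing about `α r² / N²`, hence a proportion of order `α / N`.

The local estimate rests on `g' / g`. It is at most a sum of `1 / |z - a|` over `O(A)` zeros plus
`O(A)`, while the drop of `|g|` along circles makes its integral at least a multiple of `A`.
Therefore `|g' / g|` is comparable to `A` on a set of area bounded below, even after removing
neighbourhoods of the zeros. Near each point of this set a branch of `log g` on a disc of radius `K
/ A` covers a disc of radius 16, hence a rectangle lying over `S`, and the bound on the derivative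
keeps the preimage of that rectangle large. Averaging over the set finishes the argument. -/

/-! ### Upper bound for the logarithmic derivative. -/

theorem exists_log_of_ne_zero_on_ball {k : ℂ → ℂ} {c : ℂ} {r : ℝ} (hr : 0 < r)
    (hk : DifferentiableOn ℂ k (Metric.ball c r)) (h0 : ∀ z ∈ Metric.ball c r, k z ≠ 0) :
    ∃ L : ℂ → ℂ, (∀ z ∈ Metric.ball c r, HasDerivAt L (deriv k z / k z) z) ∧
      ∀ z ∈ Metric.ball c r, Complex.exp (L z) = k z := by
  have hd : DifferentiableOn ℂ (fun z => deriv k z / k z) (Metric.ball c r) :=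
    (hk.deriv Metric.isOpen_ball).div hk h0
  have hc : c ∈ Metric.ball c r := Metric.mem_ball_self hr
  obtain ⟨L, hLc, hL⟩ := hd.isExactOn_ball.with_val_at c (Complex.log (k c))
  refine ⟨L, hL, fun z hz => ?_⟩
  have hder : ∀ z ∈ Metric.ball c r, HasDerivAt (fun z => k z * Complex.exp (-L z)) 0 z := by
    intro z hz
    have h1 := (hk.differentiableAt (Metric.isOpen_ball.mem_nhds hz)).hasDerivAt
    have h2 : HasDerivAt (fun z => k z * Complex.exp (-L z)) (deriv k z * Complex.exp (-L z) +
        k z * (Complex.exp (-L z) * -(deriv k z / k z))) z := h1.mul (hL z hz).neg.cexp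
    have e : deriv k z * Complex.exp (-L z) +
        k z * (Complex.exp (-L z) * -(deriv k z / k z)) = 0 := by
      have := h0 z hz
      field_simp
      ring
    rwa [e] at h2
  have hconst := (convex_ball c r).is_const_of_fderivWithin_eq_zero (𝕜 := ℂ)
    (f := fun z => k z * Complex.exp (-L z))
    (fun z hz => (hder z hz).differentiableAt.differentiableWithinAt)
    (fun z hz => by
      rw [fderivWithin_of_isOpen Metric.isOpen_ball hz]
      ext
      simpa using (hder z hz).deriv) hz hc
  simp only [hLc, Complex.exp_neg, Complex.exp_log (h0 c hc)] at hconst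
  rw [mul_inv_cancel₀ (h0 c hc)] at hconst
  have := Complex.exp_ne_zero (L z)
  field_simp at hconst
  exact hconst.symm

/-- Borel–Carathéodory bounds a branch of `log k` by `6 B` on radius `3 / 8`; Cauchy's estimate on
circles of radius `1 / 8` then gives `48 B`. -/
theorem norm_logDeriv_le_of_zero_free {k : ℂ → ℂ} (hk : Differentiable ℂ k) {B : ℝ} (hB : 0 < B)
    (h0 : ∀ z ∈ Metric.ball (0 : ℂ) (1 / 2), k z ≠ 0)
    (hle : ∀ z ∈ Metric.ball (0 : ℂ) (1 / 2), ‖k z‖ ≤ Real.exp B) (h1 : 1 ≤ ‖k 0‖)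
    {z : ℂ} (hz : z ∈ Metric.ball (0 : ℂ) (1 / 4)) : ‖deriv k z / k z‖ ≤ 48 * B := by
  obtain ⟨L, hL, hexp⟩ := exists_log_of_ne_zero_on_ball (by norm_num) hk.differentiableOn h0
  have hre : ∀ z ∈ Metric.ball (0 : ℂ) (1 / 2), ‖k z‖ = Real.exp (L z).re := fun z hz => by
    rw [← hexp z hz, Complex.norm_exp]
  have hLd : DifferentiableOn ℂ (fun z => L z - L 0) (Metric.ball (0 : ℂ) (1 / 2)) :=
    fun z hz => ((hL z hz).differentiableAt.sub_const _).differentiableWithinAt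
  have h00 : (0 : ℂ) ∈ Metric.ball (0 : ℂ) (1 / 2) := by simp
  have hL0 : 0 ≤ (L 0).re := by
    rw [hre 0 h00] at h1
    simpa using h1
  have hBC : ∀ w ∈ Metric.closedBall (0 : ℂ) (3 / 8), ‖L w - L 0‖ ≤ 6 * B := by
    intro w hw
    have hw' : ‖w‖ ≤ 3 / 8 := by simpa using hw
    have hm : Set.MapsTo (fun z => L z - L 0) (Metric.ball (0 : ℂ) (1 / 2)) {z | z.re ≤ B} := by
      intro z hz
      have := hle z hz
      rw [hre z hz, Real.exp_le_exp] at this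
      simp only [Set.mem_ofPred_eq, Complex.sub_re]
      linarith
    have hwb : w ∈ Metric.ball (0 : ℂ) (1 / 2) := by
      simp only [mem_ball_zero_iff]; linarith
    refine (Complex.borelCaratheodory_zero hB hLd hm (by norm_num) hwb (by simp)).trans ?_
    rw [div_le_iff₀ (by linarith)]
    nlinarith
  have hz' : ‖z‖ < 1 / 4 := by simpa using hz
  have hsub : Metric.closedBall z (1 / 8) ⊆ Metric.closedBall (0 : ℂ) (3 / 8) := by
    apply Metric.closedBall_subset_closedBall'
    rw [dist_zero_right]; linarith
  have hsub' : Metric.closedBall (0 : ℂ) (3 / 8) ⊆ Metric.ball (0 : ℂ) (1 / 2) :=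
    Metric.closedBall_subset_ball (by norm_num)
  have hcau := Complex.norm_deriv_le_of_forall_mem_sphere_norm_le (f := fun z => L z - L 0)
    (c := z) (R := 1 / 8) (C := 6 * B) (by norm_num)
    ((hLd.mono (hsub.trans hsub')).diffContOnCl_ball subset_rfl)
    (fun w hw => hBC w (hsub (Metric.sphere_subset_closedBall hw)))
  have hz2 : z ∈ Metric.ball (0 : ℂ) (1 / 2) := by simp only [mem_ball_zero_iff]; linarith
  rw [((hL z hz2).sub_const _).deriv] at hcau
  linarith

theorem norm_one_sub_conj_mul {a z : ℂ} (hz : ‖z‖ = 1) :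
    ‖1 - (starRingEnd ℂ) a * z‖ = ‖z - a‖ := by
  have h : (1 : ℂ) = (starRingEnd ℂ) z * z := by
    rw [← Complex.normSq_eq_conj_mul_self, Complex.normSq_eq_norm_sq, hz]; norm_num
  rw [h, ← sub_mul, ← map_sub, norm_mul, hz, mul_one, Complex.norm_conj]

/-- Peeling off zeros in the disc of radius `1/2` and comparing with the Blaschke product. -/
theorem blaschke_bounds {g h : ℂ → ℂ} {n : ℕ} {a : Fin n → ℂ} (hh : Differentiable ℂ h) {B : ℝ}
    (hB : ∀ z ∈ Metric.closedBall (0 : ℂ) 1, ‖g z‖ ≤ Real.exp B) (h0 : g 0 = 1)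
    (ha : ∀ j, ‖a j‖ ≤ 1 / 2) (hfac : ∀ z, g z = (∏ j, (z - a j)) * h z) :
    (∀ z ∈ Metric.closedBall (0 : ℂ) 1,
      ‖h z * ∏ j, (1 - (starRingEnd ℂ) (a j) * z)‖ ≤ Real.exp B) ∧
    1 ≤ ‖h 0‖ ∧ n * Real.log 2 ≤ B := by
  have hmax : ∀ z ∈ Metric.closedBall (0 : ℂ) 1,
      ‖h z * ∏ j, (1 - (starRingEnd ℂ) (a j) * z)‖ ≤ Real.exp B := by
    intro z hz
    rw [← closure_ball (0 : ℂ) one_ne_zero] at hz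
    refine Complex.norm_le_of_forall_mem_frontier_norm_le (U := Metric.ball (0 : ℂ) 1)
      (f := fun z => h z * ∏ j, (1 - (starRingEnd ℂ) (a j) * z))
      Metric.isBounded_ball (Differentiable.diffContOnCl (by fun_prop)) ?_ hz
    intro w hw
    rw [frontier_ball (0 : ℂ) one_ne_zero] at hw
    have hw1 : ‖w‖ = 1 := by simpa using hw
    rw [norm_mul, norm_prod, Finset.prod_congr rfl (fun j _ => norm_one_sub_conj_mul hw1),
      ← norm_prod, ← norm_mul, mul_comm, ← hfac]
    exact hB w (Metric.sphere_subset_closedBall hw)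
  have hp : ∏ j, ‖a j‖ ≤ (1 / 2 : ℝ) ^ n := by
    refine (Finset.prod_le_prod (fun _ _ => norm_nonneg _) (fun j _ => ha j)).trans_eq ?_
    simp
  have h2 : 1 = (∏ j, ‖a j‖) * ‖h 0‖ := by
    have := hfac 0
    rw [h0] at this
    have := congrArg norm this
    simpa [norm_prod] using this
  have h3 : (2 : ℝ) ^ n ≤ ‖h 0‖ := by
    have : 1 ≤ (1 / 2 : ℝ) ^ n * ‖h 0‖ :=
      h2.le.trans (mul_le_mul_of_nonneg_right hp (norm_nonneg _))
    rw [one_div, inv_pow, ← div_eq_inv_mul, le_div_iff₀ (by positivity)] at this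
    linarith
  refine ⟨hmax, (one_le_pow₀ one_le_two).trans h3, ?_⟩
  have h4 := hmax 0 (by simp)
  simp only [mul_zero, sub_zero, Finset.prod_const_one, mul_one] at h4
  have h5 := Real.log_le_log (by positivity) (h3.trans h4)
  rwa [Real.log_exp, Real.log_pow] at h5

/-- Zeros are divided out one at a time; the process stops because `blaschke_bounds` limits their
number by `B / log 2`. -/
theorem exists_zero_factorization {g : ℂ → ℂ} (hg : Differentiable ℂ g) {B : ℝ}
    (hB : ∀ z ∈ Metric.closedBall (0 : ℂ) 1, ‖g z‖ ≤ Real.exp B) (h0 : g 0 = 1) :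
    ∃ (n : ℕ) (a : Fin n → ℂ) (h : ℂ → ℂ), Differentiable ℂ h ∧ (∀ j, ‖a j‖ ≤ 1 / 2) ∧
      (∀ z, g z = (∏ j, (z - a j)) * h z) ∧
      ∀ z ∈ Metric.closedBall (0 : ℂ) (1 / 2), h z ≠ 0 := by
  by_contra! hcon
  have key : ∀ n : ℕ, ∃ (a : Fin n → ℂ) (h : ℂ → ℂ), Differentiable ℂ h ∧
      (∀ j, ‖a j‖ ≤ 1 / 2) ∧ (∀ z, g z = (∏ j, (z - a j)) * h z) := by
    intro n
    induction n with
    | zero => exact ⟨Fin.elim0, g, hg, fun j => j.elim0, fun z => by simp⟩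
    | succ n ih =>
      obtain ⟨a, h, hh, ha, hfac⟩ := ih
      obtain ⟨w, hw, hw0⟩ := hcon n a h hh ha hfac
      refine ⟨Fin.cons w a, dslope h w, ?_, ?_, ?_⟩
      · rw [← differentiableOn_univ] at hh ⊢
        exact (Complex.differentiableOn_dslope univ_mem).2 hh
      · intro j
        refine Fin.cases ?_ ?_ j
        · simpa using hw
        · simpa using ha
      · intro z
        rw [Fin.prod_univ_succ, hfac z]
        have := sub_smul_dslope h w z
        rw [hw0, sub_zero, smul_eq_mul] at this
        simp only [Fin.cons_zero, Fin.cons_succ]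
        rw [← this]; ring
  obtain ⟨n, hn⟩ := exists_nat_gt (B / Real.log 2)
  obtain ⟨a, h, hh, ha, hfac⟩ := key n
  have := (blaschke_bounds hh hB h0 ha hfac).2.2
  rw [div_lt_iff₀ (Real.log_pos one_lt_two)] at hn
  linarith

/-- Divide `g` by the Blaschke product of its zeros. The zero-free quotient contributes `48 B`, and
each Blaschke denominator at most 1, so at most `n ≤ 2 B` in total; 52 leaves room. -/
theorem exists_norm_logDeriv_le {g : ℂ → ℂ} (hg : Differentiable ℂ g) {B : ℝ} (hBpos : 0 < B)
    (hB : ∀ z ∈ Metric.closedBall (0 : ℂ) 1, ‖g z‖ ≤ Real.exp B) (h0 : g 0 = 1) :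
    ∃ (n : ℕ) (a : Fin n → ℂ), (n : ℝ) ≤ 2 * B ∧
      (∀ z ∈ Metric.ball (0 : ℂ) (1 / 4), (∀ j, z ≠ a j) → g z ≠ 0) ∧
      ∀ z ∈ Metric.ball (0 : ℂ) (1 / 4),
        ‖deriv g z / g z‖ ≤ (∑ j, ‖z - a j‖⁻¹) + 52 * B := by
  obtain ⟨n, a, h, hh, ha, hfac, hne⟩ := exists_zero_factorization hg hB h0
  obtain ⟨hb1, hb2, hb3⟩ := blaschke_bounds hh hB h0 ha hfac
  have hlog : (1 / 2 : ℝ) ≤ Real.log 2 := by linarith [Real.log_two_gt_d9]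
  have hn : (n : ℝ) ≤ 2 * B := by
    have : (n : ℝ) * (1 / 2) ≤ n * Real.log 2 := by gcongr
    linarith
  have hnz : ∀ z ∈ Metric.ball (0 : ℂ) (1 / 4), (∀ j, z ≠ a j) → g z ≠ 0 := by
    intro z hz hza
    rw [hfac]
    refine mul_ne_zero (Finset.prod_ne_zero_iff.2 fun j _ => sub_ne_zero.2 (hza j)) (hne z ?_)
    exact Metric.ball_subset_closedBall (Metric.ball_subset_ball (by norm_num) hz)
  refine ⟨n, a, hn, hnz, fun z hz => ?_⟩
  by_cases hgz : g z = 0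
  · rw [hgz]; simp only [div_zero, norm_zero]; positivity
  have hz' : ‖z‖ < 1 / 4 := by simpa using hz
  have hza : ∀ j, z - a j ≠ 0 := by
    intro j hj
    apply hgz
    rw [hfac, Finset.prod_eq_zero (Finset.mem_univ j) hj, zero_mul]
  have hfact : ∀ w : ℂ, ‖w‖ ≤ 1 / 2 → ∀ j, 3 / 4 ≤ ‖1 - (starRingEnd ℂ) (a j) * w‖ := by
    intro w hw j
    have h1 : ‖(starRingEnd ℂ) (a j) * w‖ ≤ 1 / 4 := by
      rw [norm_mul, Complex.norm_conj]
      nlinarith [ha j, norm_nonneg w, norm_nonneg (a j)]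
    have h2 := norm_sub_norm_le (1 : ℂ) ((starRingEnd ℂ) (a j) * w)
    rw [norm_one] at h2
    linarith
  have hfne : ∀ w : ℂ, ‖w‖ ≤ 1 / 2 → ∀ j, 1 - (starRingEnd ℂ) (a j) * w ≠ 0 := by
    intro w hw j hj
    have := hfact w hw j
    rw [hj, norm_zero] at this
    linarith
  set k : ℂ → ℂ := fun z => h z * ∏ j, (1 - (starRingEnd ℂ) (a j) * z) with hk
  have hkd : Differentiable ℂ k := by rw [hk]; fun_prop
  have hkb : ‖deriv k z / k z‖ ≤ 48 * B := by
    refine norm_logDeriv_le_of_zero_free hkd hBpos ?_ ?_ ?_ hz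
    · intro w hw
      have hw' : ‖w‖ < 1 / 2 := by simpa using hw
      exact mul_ne_zero (hne w (Metric.ball_subset_closedBall hw))
        (Finset.prod_ne_zero_iff.2 fun j _ => hfne w hw'.le j)
    · intro w hw
      exact hb1 w (Metric.ball_subset_closedBall (Metric.ball_subset_ball (by norm_num) hw))
    · simpa [hk] using hb2
  have hz2 : ‖z‖ ≤ 1 / 2 := by linarith
  have hhz : h z ≠ 0 := hne z (by simpa using hz2)
  have e1 : logDeriv k z = logDeriv h z +
      ∑ j, -(starRingEnd ℂ) (a j) / (1 - (starRingEnd ℂ) (a j) * z) := by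
    rw [hk, logDeriv_mul z hhz (Finset.prod_ne_zero_iff.2 fun j _ => hfne z hz2 j) (hh z)
      (by fun_prop)]
    congr 1
    have := logDeriv_prod (s := Finset.univ) (f := fun j (z : ℂ) => 1 - (starRingEnd ℂ) (a j) * z)
      (x := z) (fun j _ => hfne z hz2 j) (fun j _ => by fun_prop)
    rw [this]
    refine Finset.sum_congr rfl fun j _ => ?_
    rw [logDeriv_apply]
    congr 1
    simp
  have e2 : logDeriv g z = (∑ j, (z - a j)⁻¹) + logDeriv h z := by
    have hge : g = fun z => (∏ j, (z - a j)) * h z := funext hfac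
    rw [hge, logDeriv_mul z (Finset.prod_ne_zero_iff.2 fun j _ => hza j) hhz (by fun_prop) (hh z)]
    congr 1
    have := logDeriv_prod (s := Finset.univ) (f := fun j (z : ℂ) => z - a j)
      (x := z) (fun j _ => hza j) (fun j _ => by fun_prop)
    rw [this]
    refine Finset.sum_congr rfl fun j _ => ?_
    rw [logDeriv_apply, ((hasDerivAt_id' z).sub_const (a j)).deriv, one_div]
  have e3 : deriv g z / g z = (∑ j, (z - a j)⁻¹) + deriv k z / k z
      - ∑ j, -(starRingEnd ℂ) (a j) / (1 - (starRingEnd ℂ) (a j) * z) := by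
    rw [← logDeriv_apply, ← logDeriv_apply, e1, e2]; ring
  have b1 : ‖∑ j, (z - a j)⁻¹‖ ≤ ∑ j, ‖z - a j‖⁻¹ := by
    refine (norm_sum_le _ _).trans_eq ?_
    simp
  have b2 : ‖∑ j, -(starRingEnd ℂ) (a j) / (1 - (starRingEnd ℂ) (a j) * z)‖ ≤ n := by
    refine (norm_sum_le _ _).trans ?_
    refine (Finset.sum_le_card_nsmul _ _ 1 fun j _ => ?_).trans_eq (by simp)
    rw [norm_div, norm_neg, Complex.norm_conj, div_le_one (by linarith [hfact z hz2 j])]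
    linarith [hfact z hz2 j, ha j]
  rw [e3]
  have t1 := norm_sub_le ((∑ j, (z - a j)⁻¹) + deriv k z / k z)
    (∑ j, -(starRingEnd ℂ) (a j) / (1 - (starRingEnd ℂ) (a j) * z))
  have t2 := norm_add_le (∑ j, (z - a j)⁻¹) (deriv k z / k z)
  linarith

/-! ### Sectors in logarithmic coordinates and the preimage near one good point. -/

theorem exp_mem_sector {θ₁ θ₂ : ℝ} {w : ℂ} (k : ℤ) (h1 : θ₁ + k * (2 * Real.pi) < w.im)
    (h2 : w.im < θ₂ + k * (2 * Real.pi)) : Complex.exp w ∈ sector θ₁ θ₂ := by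
  refine ⟨Real.exp w.re, w.im - k * (2 * Real.pi), Real.exp_pos _, by linarith, by linarith, ?_⟩
  rw [Complex.ofReal_exp, ← Complex.exp_add]
  apply Complex.exp_eq_exp_iff_exists_int.2
  refine ⟨k, ?_⟩
  apply Complex.ext <;> simp

theorem isOpen_sector (θ₁ θ₂ : ℝ) : IsOpen (sector θ₁ θ₂) := by
  have h : sector θ₁ θ₂ = Complex.exp '' (Complex.im ⁻¹' Set.Ioo θ₁ θ₂) := by
    ext w
    constructor
    · rintro ⟨t, θ, ht, h1, h2, rfl⟩
      refine ⟨Real.log t + θ * Complex.I, by simp [h1, h2], ?_⟩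
      rw [Complex.exp_add, ← Complex.ofReal_exp, Real.exp_log ht]
    · rintro ⟨w, ⟨h1, h2⟩, rfl⟩
      exact exp_mem_sector 0 (by simpa using h1) (by simpa using h2)
  rw [h]
  exact Complex.isOpenMap_exp _ (isOpen_Ioo.preimage Complex.continuous_im)

theorem mul_mem_sector_iff {θ₁ θ₂ φ s : ℝ} (hs : 0 < s) {w : ℂ} :
    s * Complex.exp (φ * Complex.I) * w ∈ sector θ₁ θ₂ ↔ w ∈ sector (θ₁ - φ) (θ₂ - φ) := by
  have hs' : (s : ℂ) ≠ 0 := by exact_mod_cast hs.ne'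
  constructor
  · rintro ⟨t, θ, ht, h1, h2, h⟩
    refine ⟨t / s, θ - φ, by positivity, by linarith, by linarith, ?_⟩
    have he := Complex.exp_ne_zero (φ * Complex.I)
    push_cast
    rw [sub_mul, Complex.exp_sub]
    field_simp
    rw [← h]; ring_nf
  · rintro ⟨t, θ, ht, h1, h2, rfl⟩
    refine ⟨s * t, θ + φ, by positivity, by linarith, by linarith, ?_⟩
    push_cast
    rw [add_mul, Complex.exp_add]
    ring

theorem exists_isOpen_subset_exp_preimage_sector (w : ℂ) {θ₁ θ₂ : ℝ}
    (hle : θ₂ ≤ θ₁ + 2 * Real.pi) :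
    ∃ Q : Set ℂ, IsOpen Q ∧ Q ⊆ Metric.ball w 16 ∧ (∀ v ∈ Q, Complex.exp v ∈ sector θ₁ θ₂) ∧
      volume Q = ENNReal.ofReal (θ₂ - θ₁) := by
  have hpi := Real.pi_pos
  have hpi4 := Real.pi_lt_four
  -- This period places the rectangle within `2π < 8` of `w` vertically; its width is 1, so radius
  -- 16 suffices.
  set k : ℤ := ⌊(w.im - θ₁) / (2 * Real.pi)⌋ with hk
  have hk1 : k * (2 * Real.pi) ≤ w.im - θ₁ := by
    rw [← le_div_iff₀ (by positivity)]; exact Int.floor_le _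
  have hk2 : w.im - θ₁ < (k + 1) * (2 * Real.pi) := by
    rw [← div_lt_iff₀ (by positivity)]; exact Int.lt_floor_add_one _
  have hQ : (Set.Ioo w.re (w.re + 1) ×ℂ
      Set.Ioo (θ₁ + k * (2 * Real.pi)) (θ₂ + k * (2 * Real.pi))) =
      Complex.measurableEquivRealProd ⁻¹' (Set.Ioo w.re (w.re + 1) ×ˢ
      Set.Ioo (θ₁ + k * (2 * Real.pi)) (θ₂ + k * (2 * Real.pi))) := by
    ext v; simp [Complex.mem_reProdIm]
  refine ⟨Set.Ioo w.re (w.re + 1) ×ℂ Set.Ioo (θ₁ + k * (2 * Real.pi)) (θ₂ + k * (2 * Real.pi)),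
    isOpen_Ioo.reProdIm isOpen_Ioo, ?_, ?_, ?_⟩
  · intro v hv
    rw [Complex.mem_reProdIm] at hv
    obtain ⟨⟨h1, h2⟩, h3, h4⟩ := hv
    rw [mem_ball_iff_norm]
    refine (Complex.norm_le_abs_re_add_abs_im _).trans_lt ?_
    have e1 : |(v - w).re| ≤ 1 := by
      rw [Complex.sub_re, abs_le]; constructor <;> linarith
    have e2 : |(v - w).im| ≤ 8 := by
      rw [Complex.sub_im, abs_le]; constructor <;> linarith
    linarith
  · intro v hv
    rw [Complex.mem_reProdIm] at hv
    exact exp_mem_sector k hv.2.1 hv.2.2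
  · rw [hQ, Complex.volume_preserving_equiv_real_prod.measure_preimage_equiv,
      Measure.volume_eq_prod, Measure.prod_prod, Real.volume_Ioo, Real.volume_Ioo]
    simp

theorem volume_image_le_of_norm_deriv_le {F F' : ℂ → ℂ} {X : Set ℂ} (hX : MeasurableSet X)
    {Λ : ℝ} (hF : ∀ z ∈ X, HasDerivAt F (F' z) z) (hle : ∀ z ∈ X, ‖F' z‖ ≤ Λ) :
    volume (F '' X) ≤ ENNReal.ofReal (Λ ^ 2) * volume X := by
  refine (addHaar_image_le_lintegral_abs_det_fderiv volume hX
    (fun z hz => ((hF z hz).hasFDerivAt.restrictScalars ℝ).hasFDerivWithinAt)).trans ?_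
  rw [← setLIntegral_const]
  refine setLIntegral_mono' hX fun z hz => ENNReal.ofReal_le_ofReal ?_
  have : |ContinuousLinearMap.det ((ContinuousLinearMap.toSpanSingleton ℂ (F' z)).restrictScalars ℝ)|
      = ‖F' z‖ ^ 2 := by
    simp [ContinuousLinearMap.det, LinearMap.det_restrictScalars,
      Algebra.norm_complex_eq, Complex.normSq_eq_norm_sq]
  rw [this]
  exact pow_le_pow_left₀ (norm_nonneg _) (hle z hz) 2

/-- A quantitative open mapping argument for `F = log g`: its image contains a rectangle of area `θ₂
- θ₁` over the sector, and `F` expands area by at most `Λ ^ 2`. -/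
theorem volume_preimage_sector_ball_ge {g : ℂ → ℂ} (hg : Differentiable ℂ g) {z : ℂ}
    {R c Λ : ℝ} (hR : 0 < R) (hc : 0 < c) (hcΛ : c ≤ Λ) (hRc : 256 * Λ ≤ R * c ^ 2)
    (h0 : ∀ w ∈ Metric.ball z R, g w ≠ 0)
    (hle : ∀ w ∈ Metric.ball z R, ‖deriv g w / g w‖ ≤ Λ) (hge : c ≤ ‖deriv g z / g z‖)
    {θ₁ θ₂ : ℝ} (hθ : θ₂ ≤ θ₁ + 2 * Real.pi) :
    ENNReal.ofReal ((θ₂ - θ₁) / Λ ^ 2) ≤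
      volume (g ⁻¹' sector θ₁ θ₂ ∩ Metric.ball z R) := by
  have hΛ : 0 < Λ := hc.trans_le hcΛ
  obtain ⟨F, hF, hexp⟩ := exists_log_of_ne_zero_on_ball hR hg.differentiableOn h0
  set F' : ℂ → ℂ := fun w => deriv g w / g w with hF'
  have hzR : z ∈ Metric.ball z R := Metric.mem_ball_self hR
  have hF'd : DifferentiableOn ℂ F' (Metric.ball z R) :=
    (hg.differentiableOn.deriv Metric.isOpen_ball).div hg.differentiableOn h0
  -- By the Schwarz lemma `F'` varies by at most `2 Λ δ / R = c / 2` on this disc, so `F` stays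
  -- close to its linear part.
  set δ : ℝ := R * c / (4 * Λ) with hδ
  have hδpos : 0 < δ := by positivity
  have hδR : δ < R := by
    rw [hδ, div_lt_iff₀ (by positivity)]
    nlinarith
  have hclose : ∀ w ∈ Metric.closedBall z δ, ‖F' w - F' z‖ ≤ c / 2 := by
    intro w hw
    have hwR : w ∈ Metric.ball z R := Metric.closedBall_subset_ball hδR hw
    have := Complex.dist_le_div_mul_dist_of_mapsTo_ball (R₂ := 2 * Λ) hF'd (fun v hv => by
      rw [mem_closedBall_iff_norm]
      exact (norm_sub_le _ _).trans (by linarith [hle v hv, hle z hzR])) hwR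
    rw [dist_eq_norm] at this
    refine this.trans ?_
    calc 2 * Λ / R * dist w z ≤ 2 * Λ / R * δ := by
          gcongr; exact hw
      _ = c / 2 := by rw [hδ]; field_simp; ring
  have hsph : ∀ w ∈ Metric.sphere z δ, c * δ / 2 ≤ ‖F w - F z‖ := by
    intro w hw
    have hwc : w ∈ Metric.closedBall z δ := Metric.sphere_subset_closedBall hw
    have hmv := (convex_closedBall z δ).norm_image_sub_le_of_norm_hasDerivWithin_le
      (f := fun v => F v - F' z * v) (f' := fun v => F' v - F' z) (C := c / 2)
      (fun v hv => (by
        have h1 := hF v (Metric.closedBall_subset_ball hδR hv)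
        have h2 := (hasDerivAt_id' v).const_mul (F' z)
        rw [mul_one] at h2
        exact (h1.sub h2).hasDerivWithinAt)) hclose (Metric.mem_closedBall_self hδpos.le) hwc
    have hwδ : ‖w - z‖ = δ := by simpa [dist_eq_norm] using hw
    rw [hwδ] at hmv
    have e : F' z * (w - z) = (F w - F z) - (F w - F' z * w - (F z - F' z * z)) := by ring
    have h3 : ‖F' z * (w - z)‖ ≤ ‖F w - F z‖ + c / 2 * δ := by
      rw [e]
      exact (norm_sub_le _ _).trans (by linarith)
    rw [norm_mul, hwδ] at h3
    have h4 : c * δ ≤ ‖F' z‖ * δ := by gcongr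
    linarith
  have hdc : DiffContOnCl ℂ F (Metric.ball z δ) :=
    DifferentiableOn.diffContOnCl_ball (U := Metric.ball z R)
      (fun w hw => (hF w hw).differentiableAt.differentiableWithinAt)
      (Metric.closedBall_subset_ball hδR)
  have hfreq : ∃ᶠ w in 𝓝 z, F w ≠ F z := by
    have hne : F' z ≠ 0 := norm_pos_iff.1 (hc.trans_le hge)
    exact ((hF z hzR).eventually_ne hne).frequently.filter_mono nhdsWithin_le_nhds
  have himg := hdc.ball_subset_image_closedBall hδpos hsph hfreq
  obtain ⟨Q, hQo, hQb, hQs, hQv⟩ := exists_isOpen_subset_exp_preimage_sector (F z) hθ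
  -- One factor `1 / 2` comes from `hsph`, the other from the open mapping lemma; this is where `256
  -- * Λ ≤ R * c ^ 2` is used.
  have h16 : 16 ≤ c * δ / 2 / 2 := by
    rw [hδ]
    have : c * (R * c / (4 * Λ)) / 2 / 2 = R * c ^ 2 / (16 * Λ) := by field_simp; ring
    rw [this, le_div_iff₀ (by positivity)]
    linarith
  set X : Set ℂ := Metric.ball z R ∩ F ⁻¹' Q with hX
  have hXo : IsOpen X := by
    refine ContinuousOn.isOpen_inter_preimage ?_ Metric.isOpen_ball hQo
    exact fun w hw => (hF w hw).continuousAt.continuousWithinAt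
  have hQX : Q ⊆ F '' X := by
    intro v hv
    obtain ⟨w, hw, rfl⟩ := himg (Metric.ball_subset_ball h16 (hQb hv))
    exact ⟨w, ⟨Metric.closedBall_subset_ball hδR hw, hv⟩, rfl⟩
  have hXS : X ⊆ g ⁻¹' sector θ₁ θ₂ ∩ Metric.ball z R := by
    rintro w ⟨hw, hwQ⟩
    refine ⟨?_, hw⟩
    rw [Set.mem_preimage, ← hexp w hw]
    exact hQs _ hwQ
  have hvol : ENNReal.ofReal (θ₂ - θ₁) ≤ ENNReal.ofReal (Λ ^ 2) * volume X := by
    rw [← hQv]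
    exact (measure_mono hQX).trans (volume_image_le_of_norm_deriv_le hXo.measurableSet
      (fun w hw => hF w hw.1) (fun w hw => hle w hw.1))
  refine le_trans ?_ (measure_mono hXS)
  rw [ENNReal.ofReal_div_of_pos (by positivity)]
  exact ENNReal.div_le_of_le_mul' hvol

/-! ### Lower bound for the integral of the logarithmic derivative. -/

theorem log_norm_sub_le_lintegral {γ γ' : ℝ → ℂ} {a b : ℝ} (hab : a ≤ b)
    (hγ : ∀ t, HasDerivAt γ (γ' t) t) (hγ' : Continuous γ') (h0 : ∀ t ∈ Set.Icc a b, γ t ≠ 0) :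
    ENNReal.ofReal (Real.log ‖γ a‖ - Real.log ‖γ b‖) ≤
      ∫⁻ t in Set.Ioc a b, ENNReal.ofReal ‖γ' t / γ t‖ := by
  have hγc : Continuous γ := continuous_iff_continuousAt.2 fun t => (hγ t).continuousAt
  -- Differentiating `log ‖γ‖²` avoids choosing a branch of the complex logarithm; the price is the
  -- factor 2 cancelled at the end.
  set h' : ℝ → ℝ := fun t => 2 * inner ℝ (γ t) (γ' t) / ‖γ t‖ ^ 2 with hh'
  have hder : ∀ t ∈ Set.Icc a b, HasDerivAt (fun t => Real.log (‖γ t‖ ^ 2)) (h' t) t :=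
    fun t ht => (hγ t).norm_sq.log (pow_ne_zero 2 (norm_ne_zero_iff.2 (h0 t ht)))
  have hcont : ContinuousOn h' (Set.uIcc a b) := by
    rw [Set.uIcc_of_le hab]
    refine ContinuousOn.div (by fun_prop) (by fun_prop) fun t ht => ?_
    exact pow_ne_zero 2 (norm_ne_zero_iff.2 (h0 t ht))
  have hftc := intervalIntegral.integral_eq_sub_of_hasDerivAt
    (fun t ht => hder t (by rwa [Set.uIcc_of_le hab] at ht)) hcont.intervalIntegrable
  rw [intervalIntegral.integral_of_le hab] at hftc
  simp only [Real.log_pow, Nat.cast_ofNat] at hftc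
  have hle : ∀ t ∈ Set.Ioc a b, ENNReal.ofReal |h' t| ≤ 2 * ENNReal.ofReal ‖γ' t / γ t‖ := by
    intro t ht
    have hp : 0 < ‖γ t‖ := norm_pos_iff.2 (h0 t (Set.Ioc_subset_Icc_self ht))
    rw [← ENNReal.ofReal_ofNat, ← ENNReal.ofReal_mul (by norm_num)]
    refine ENNReal.ofReal_le_ofReal ?_
    rw [hh', abs_div, abs_mul, abs_of_pos (by positivity : 0 < ‖γ t‖ ^ 2), norm_div,
      abs_of_pos (by norm_num : (0 : ℝ) < 2), div_le_iff₀ (by positivity)]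
    have := abs_real_inner_le_norm (γ t) (γ' t)
    have e : 2 * (‖γ' t‖ / ‖γ t‖) * ‖γ t‖ ^ 2 = 2 * (‖γ t‖ * ‖γ' t‖) := by
      field_simp
    rw [e]
    gcongr
  have h1 : ENNReal.ofReal |∫ t in Set.Ioc a b, h' t| ≤
      2 * ∫⁻ t in Set.Ioc a b, ENNReal.ofReal ‖γ' t / γ t‖ := by
    rw [← Real.enorm_eq_ofReal_abs, ← lintegral_const_mul' _ _ (by norm_num)]
    refine (enorm_integral_le_lintegral_enorm _).trans ?_
    refine setLIntegral_mono' measurableSet_Ioc fun t ht => ?_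
    rw [Real.enorm_eq_ofReal_abs]
    exact hle t ht
  rw [hftc] at h1
  have h2 : 2 * ENNReal.ofReal (Real.log ‖γ a‖ - Real.log ‖γ b‖) ≤
      2 * ∫⁻ t in Set.Ioc a b, ENNReal.ofReal ‖γ' t / γ t‖ := by
    refine le_trans ?_ h1
    rw [← ENNReal.ofReal_ofNat, ← ENNReal.ofReal_mul (by norm_num)]
    refine ENNReal.ofReal_le_ofReal ?_
    rw [abs_sub_comm, ← mul_sub]
    exact le_abs_self _
  rwa [ENNReal.mul_le_mul_iff_right (by norm_num) (by norm_num)] at h2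

theorem exists_norm_ge_on_circle {g : ℂ → ℂ} (hg : Differentiable ℂ g) {t : ℝ} (ht : 0 < t) :
    ∃ w : ℂ, ‖w‖ = t ∧ ‖g 0‖ ≤ ‖g w‖ := by
  obtain ⟨w, hw, hmax⟩ := Complex.exists_mem_frontier_isMaxOn_norm (f := g)
    (Metric.isBounded_ball (x := (0 : ℂ)) (r := t)) (by simpa using ht) hg.diffContOnCl
  rw [frontier_ball _ ht.ne'] at hw
  refine ⟨w, by simpa using hw, hmax ?_⟩
  rw [closure_ball _ ht.ne']
  simpa using ht.le

/-- The maximum principle gives a point `w` of the circle with `|g w| ≥ 1`, so `log |g|` drops by at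
least `A t` along the arc from `w` to `-t`. Arc length contributes the factor `t`, which cancels. -/
theorem ofReal_le_circle_lintegral_logDeriv {g : ℂ → ℂ} (hg : Differentiable ℂ g) (h0 : g 0 = 1)
    {A t : ℝ} (ht : 0 < t) (hA : ‖g (-t)‖ ≤ Real.exp (-(A * t)))
    (hne : ∀ z : ℂ, ‖z‖ = t → g z ≠ 0) :
    ENNReal.ofReal A ≤ ∫⁻ θ in Set.Ioo (-Real.pi) Real.pi,
      ENNReal.ofReal ‖deriv g (Complex.polarCoord.symm (t, θ)) /
        g (Complex.polarCoord.symm (t, θ))‖ := by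
  obtain ⟨w, hw, hgw⟩ := exists_norm_ge_on_circle hg ht
  rw [h0, norm_one] at hgw
  set c : ℝ → ℂ := fun θ => t * Complex.exp (θ * Complex.I) with hc
  have hpc : ∀ θ, Complex.polarCoord.symm (t, θ) = c θ := fun θ => by
    simp only [Complex.polarCoord_symm_apply, hc, Complex.exp_mul_I]
    simp
  have hcn : ∀ θ, ‖c θ‖ = t := fun θ => by
    rw [hc]; simp [Complex.norm_exp_ofReal_mul_I, abs_of_pos ht]
  have hcd : ∀ θ, HasDerivAt c (c θ * Complex.I) θ := fun θ => by
    have h1 : HasDerivAt (fun θ : ℝ => (θ : ℂ) * Complex.I) Complex.I θ := by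
      simpa using (Complex.ofRealCLM.hasDerivAt (x := θ)).mul_const Complex.I
    have := h1.cexp.const_mul (t : ℂ)
    rw [← mul_assoc] at this
    exact this
  have hcc : Continuous c := continuous_iff_continuousAt.2 fun θ => (hcd θ).continuousAt
  have hgd : Continuous (deriv g) := (hg.contDiff (n := 1)).continuous_deriv le_rfl
  have hγ : ∀ θ, HasDerivAt (fun θ => g (c θ)) (deriv g (c θ) * (c θ * Complex.I)) θ :=
    fun θ => (hg (c θ)).hasDerivAt.comp θ (hcd θ)
  have key := log_norm_sub_le_lintegral (Complex.arg_le_pi w) hγ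
    (by fun_prop) (fun θ _ => hne _ (hcn θ))
  have e1 : c w.arg = w := by
    simp only [hc]; rw [← hw]; exact Complex.norm_mul_exp_arg_mul_I w
  have e2 : c Real.pi = -t := by
    simp only [hc]; rw [Complex.exp_pi_mul_I]; ring
  rw [e1, e2] at key
  have hlog : A * t ≤ Real.log ‖g w‖ - Real.log ‖g (-t)‖ := by
    have i1 : 0 ≤ Real.log ‖g w‖ := Real.log_nonneg hgw
    have i2 : Real.log ‖g (-t)‖ ≤ -(A * t) := by
      rw [Real.log_le_iff_le_exp (norm_pos_iff.2 (hne _ (by simp [abs_of_pos ht])))]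
      exact hA
    linarith
  have key2 : ENNReal.ofReal (A * t) ≤ ENNReal.ofReal t *
      ∫⁻ θ in Set.Ioo (-Real.pi) Real.pi, ENNReal.ofReal ‖deriv g (c θ) / g (c θ)‖ := by
    rw [← lintegral_const_mul' _ _ ENNReal.ofReal_ne_top, restrict_Ioo_eq_restrict_Ioc]
    refine ((ENNReal.ofReal_le_ofReal hlog).trans key).trans ?_
    refine (lintegral_mono_set (Set.Ioc_subset_Ioc_left (Complex.neg_pi_lt_arg w).le)).trans_eq ?_
    refine lintegral_congr fun θ => ?_
    rw [← ENNReal.ofReal_mul ht.le, norm_div, norm_mul, norm_mul, Complex.norm_I, hcn, norm_div]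
    congr 1; ring
  rw [mul_comm, ENNReal.ofReal_mul ht.le,
    ENNReal.mul_le_mul_iff_right (by simpa using ht) ENNReal.ofReal_ne_top] at key2
  simpa only [hpc] using key2

theorem lintegral_Ioo_ofReal_mul {A r : ℝ} (hA : 0 ≤ A) (hr : 0 ≤ r) :
    ∫⁻ t in Set.Ioo 0 r, ENNReal.ofReal (t * A) = ENNReal.ofReal (A * r ^ 2 / 2) := by
  rw [restrict_Ioo_eq_restrict_Ioc, ← ofReal_integral_eq_lintegral_ofReal,
    ← intervalIntegral.integral_of_le hr, intervalIntegral.integral_mul_const, integral_id]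
  · congr 1; ring
  · exact (Continuous.integrableOn_Icc (by fun_prop)).mono_set Set.Ioc_subset_Icc_self
  · filter_upwards [ae_restrict_mem measurableSet_Ioc] with t ht
    exact mul_nonneg ht.1.le hA

theorem lintegral_ball_logDeriv_ge {g : ℂ → ℂ} (hg : Differentiable ℂ g) (h0 : g 0 = 1)
    {A r : ℝ} (hA0 : 0 ≤ A) (hr : 0 < r)
    (hA : ∀ t : ℝ, 0 < t → t < r → ‖g (-t)‖ ≤ Real.exp (-(A * t)))
    {n : ℕ} {a : Fin n → ℂ}
    (hne : ∀ z ∈ Metric.ball (0 : ℂ) r, (∀ j, z ≠ a j) → g z ≠ 0) :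
    ENNReal.ofReal (A * r ^ 2 / 2) ≤
      ∫⁻ z in Metric.ball (0 : ℂ) r, ENNReal.ofReal ‖deriv g z / g z‖ := by
  have hgd : Continuous (deriv g) := (hg.contDiff (n := 1)).continuous_deriv le_rfl
  have hmeas : Measurable fun z => ENNReal.ofReal ‖deriv g z / g z‖ :=
    (hgd.measurable.div hg.continuous.measurable).norm.ennreal_ofReal
  rw [← lintegral_indicator Metric.isOpen_ball.measurableSet,
    ← Complex.lintegral_comp_polarCoord_symm, polarCoord_target, Measure.volume_eq_prod,
    ← Measure.prod_restrict, lintegral_prod]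
  swap
  · refine Measurable.aemeasurable ?_
    refine (ENNReal.measurable_ofReal.comp measurable_fst).smul ?_
    refine (hmeas.indicator Metric.isOpen_ball.measurableSet).comp ?_
    change Measurable fun p : ℝ × ℝ => Complex.polarCoord.symm p
    simp only [Complex.polarCoord_symm_apply]
    fun_prop
  have hfin : Set.Finite (Set.range fun j => ‖a j‖) := Set.finite_range _
  -- Circles through a zero are excluded; they occur for finitely many radii only.
  have hae : ∀ᵐ t : ℝ, t ∉ Set.range fun j => ‖a j‖ :=
    measure_eq_zero_iff_ae_notMem.1 (hfin.measure_zero volume)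
  rw [← lintegral_Ioo_ofReal_mul hA0 hr.le]
  refine (lintegral_mono_ae ?_).trans
    (lintegral_mono_set (Set.Ioo_subset_Ioi_self : Set.Ioo 0 r ⊆ Set.Ioi 0))
  filter_upwards [ae_restrict_mem measurableSet_Ioo, ae_restrict_of_ae hae] with t ht hta
  simp only [smul_eq_mul]
  rw [lintegral_const_mul' _ _ ENNReal.ofReal_ne_top, ENNReal.ofReal_mul ht.1.le]
  gcongr
  have hb : ∀ θ : ℝ, Complex.polarCoord.symm (t, θ) ∈ Metric.ball (0 : ℂ) r := fun θ => by
    rw [mem_ball_zero_iff, Complex.norm_polarCoord_symm, abs_of_pos ht.1]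
    exact ht.2
  simp only [Set.indicator_of_mem (hb _)]
  refine ofReal_le_circle_lintegral_logDeriv hg h0 ht.1 (hA t ht.1 ht.2) fun z hz => ?_
  refine hne z (by simpa [hz] using ht.2) fun j hj => hta ⟨j, ?_⟩
  simp only [← hj, hz]

/-! ### Integrals of the polar terms over small sets, and an averaging lemma. -/

theorem lintegral_ball_inv_norm_sub (a : ℂ) (δ : ℝ) :
    ∫⁻ z in Metric.ball a δ, ENNReal.ofReal ‖z - a‖⁻¹ = ENNReal.ofReal (2 * Real.pi * δ) := by
  classical
  set f : ℂ → ENNReal := (Metric.ball (0 : ℂ) δ).indicator fun z => ENNReal.ofReal ‖z‖⁻¹ with hf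
  have hfm : Measurable f :=
    (measurable_norm.inv.ennreal_ofReal).indicator Metric.isOpen_ball.measurableSet
  have h1 : ∫⁻ z in Metric.ball a δ, ENNReal.ofReal ‖z - a‖⁻¹ = ∫⁻ z, f z := by
    rw [← lintegral_indicator Metric.isOpen_ball.measurableSet,
      ← lintegral_sub_right_eq_self f a]
    refine lintegral_congr fun z => ?_
    simp only [hf, Set.indicator_apply, mem_ball_iff_norm, sub_zero]
  rw [h1, ← Complex.lintegral_comp_polarCoord_symm, polarCoord_target, Measure.volume_eq_prod,
    ← Measure.prod_restrict, lintegral_prod]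
  swap
  · refine Measurable.aemeasurable ?_
    refine (ENNReal.measurable_ofReal.comp measurable_fst).smul (hfm.comp ?_)
    change Measurable fun p : ℝ × ℝ => Complex.polarCoord.symm p
    simp only [Complex.polarCoord_symm_apply]
    fun_prop
  have h2 : ∀ t ∈ Set.Ioi (0 : ℝ), ∫⁻ θ in Set.Ioo (-Real.pi) Real.pi,
      ENNReal.ofReal t • f (Complex.polarCoord.symm (t, θ)) =
      (Set.Iio δ).indicator (fun _ => ENNReal.ofReal (2 * Real.pi)) t := by
    intro t ht
    have ht' : (0 : ℝ) < t := ht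
    have h3 : ∀ θ : ℝ, ENNReal.ofReal t • f (Complex.polarCoord.symm (t, θ)) =
        (Set.Iio δ).indicator (fun _ => 1) t := by
      intro θ
      simp only [hf, Set.indicator_apply, mem_ball_zero_iff, Complex.norm_polarCoord_symm,
        abs_of_pos ht', Set.mem_Iio]
      split_ifs
      · rw [smul_eq_mul, ← ENNReal.ofReal_mul ht'.le, mul_inv_cancel₀ ht'.ne', ENNReal.ofReal_one]
      · simp
    simp only [h3, lintegral_const, Measure.restrict_apply_univ, Real.volume_Ioo,
      Set.indicator_apply]
    split_ifs
    · rw [one_mul]; congr 1; ring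
    · simp
  rw [setLIntegral_congr_fun measurableSet_Ioi h2, lintegral_indicator measurableSet_Iio,
    lintegral_const, Measure.restrict_apply_univ, Measure.restrict_apply measurableSet_Iio,
    Set.inter_comm, Set.Ioi_inter_Iio, Real.volume_Ioo, sub_zero,
    ← ENNReal.ofReal_mul (by positivity)]

theorem volume_ball_eq_ofReal (a : ℂ) {r : ℝ} (hr : 0 ≤ r) :
    volume (Metric.ball a r) = ENNReal.ofReal (Real.pi * r ^ 2) := by
  rw [Complex.volume_ball, ← ENNReal.ofReal_pow hr, ← ENNReal.ofReal_coe_nnreal,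
    NNReal.coe_real_pi, ← ENNReal.ofReal_mul (by positivity), mul_comm]

/-- Uniform integrability of `1 / |z - a|`: first `δ`, then the area of `E`, can be taken small,
independently of `a`. -/
theorem setLIntegral_inv_norm_sub_le (a : ℂ) (E : Set ℂ) {δ : ℝ} (hδ : 0 < δ) :
    ∫⁻ z in E, ENNReal.ofReal ‖z - a‖⁻¹ ≤
      ENNReal.ofReal (2 * Real.pi * δ) + ENNReal.ofReal δ⁻¹ * volume E := by
  rw [← lintegral_inter_add_sdiff _ E (Metric.isOpen_ball (x := a) (ε := δ)).measurableSet]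
  gcongr
  · rw [← lintegral_ball_inv_norm_sub a δ]
    exact lintegral_mono_set Set.inter_subset_right
  · calc ∫⁻ z in E \ Metric.ball a δ, ENNReal.ofReal ‖z - a‖⁻¹
        ≤ ∫⁻ z in E \ Metric.ball a δ, ENNReal.ofReal δ⁻¹ := by
          refine lintegral_mono_ae ?_
          have : ∀ᵐ z ∂(volume.restrict (E \ Metric.ball a δ)), z ∈ (Metric.ball a δ)ᶜ :=
            ae_mono (Measure.restrict_mono (fun z hz => hz.2) le_rfl)
              (ae_restrict_mem Metric.isOpen_ball.measurableSet.compl)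
          filter_upwards [this] with z hz
          refine ENNReal.ofReal_le_ofReal (inv_anti₀ hδ ?_)
          simpa [dist_eq_norm] using hz
      _ ≤ ENNReal.ofReal δ⁻¹ * volume E := by
          rw [setLIntegral_const]
          gcongr
          exact Set.sdiff_subset

/-- Fubini for the pairs `(z, w)` with `w ∈ U` and `|z - w| < R`. It replaces a covering argument.
-/
theorem measure_mul_le_of_forall_le_ball {U G : Set ℂ} (hU : MeasurableSet U)
    {R : ℝ} {v : ENNReal} (h : ∀ z ∈ G, v ≤ volume (U ∩ Metric.ball z R)) :
    v * volume G ≤ volume U * volume (Metric.ball (0 : ℂ) R) := by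
  have hm : MeasurableSet {p : ℂ × ℂ | dist p.2 p.1 < R} :=
    (isOpen_lt (by fun_prop) continuous_const).measurableSet
  calc v * volume G = ∫⁻ z in G, v := by rw [setLIntegral_const]
    _ ≤ ∫⁻ z in G, volume (U ∩ Metric.ball z R) := by
        refine setLIntegral_mono ?_ h
        have hz : (fun z => volume (U ∩ Metric.ball z R)) = fun z =>
            volume.restrict U (Prod.mk z ⁻¹' {p : ℂ × ℂ | dist p.2 p.1 < R}) := by
          funext z
          rw [Measure.restrict_apply' hU, Set.inter_comm]
          rfl
        rw [hz]
        exact measurable_measure_prodMk_left hm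
    _ ≤ ∫⁻ z, volume (U ∩ Metric.ball z R) := setLIntegral_le_lintegral _ _
    _ = ∫⁻ z, ∫⁻ w in U, {p : ℂ × ℂ | dist p.2 p.1 < R}.indicator 1 (z, w) := by
        refine lintegral_congr fun z => ?_
        have : ∀ w, {p : ℂ × ℂ | dist p.2 p.1 < R}.indicator (1 : ℂ × ℂ → ENNReal) (z, w) =
          (Metric.ball z R).indicator 1 w := fun w => rfl
        simp only [this]
        rw [lintegral_indicator_one Metric.isOpen_ball.measurableSet,
          Measure.restrict_apply' hU, Set.inter_comm]
    _ = ∫⁻ w in U, ∫⁻ z, {p : ℂ × ℂ | dist p.2 p.1 < R}.indicator 1 (z, w) :=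
        lintegral_lintegral_swap (measurable_one.indicator hm).aemeasurable
    _ = ∫⁻ w in U, volume (Metric.ball (0 : ℂ) R) := by
        refine lintegral_congr fun w => ?_
        have : ∀ z, {p : ℂ × ℂ | dist p.2 p.1 < R}.indicator (1 : ℂ × ℂ → ENNReal) (z, w) =
          (Metric.ball w R).indicator 1 z := fun z => by
            classical
            simp only [Set.indicator_apply, Metric.mem_ball, dist_comm z w, Set.mem_ofPred_eq,
              Pi.one_apply]
        simp only [this]
        rw [lintegral_indicator_one Metric.isOpen_ball.measurableSet, Complex.volume_ball,
          Complex.volume_ball]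
    _ = volume U * volume (Metric.ball (0 : ℂ) R) := by rw [setLIntegral_const, mul_comm]

theorem setLIntegral_sum_inv_norm_sub_le {n : ℕ} (a : Fin n → ℂ) {E : Set ℂ} {δ η : ℝ}
    (hδ : 0 < δ) (hη : 0 ≤ η) (hE : volume E ≤ ENNReal.ofReal η) :
    ∫⁻ z in E, ENNReal.ofReal (∑ j, ‖z - a j‖⁻¹) ≤
      ENNReal.ofReal (n * (2 * Real.pi * δ + η / δ)) := by
  have hpi := Real.pi_pos
  have : ∀ z, ENNReal.ofReal (∑ j, ‖z - a j‖⁻¹) = ∑ j, ENNReal.ofReal ‖z - a j‖⁻¹ := fun z =>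
    ENNReal.ofReal_sum_of_nonneg fun j _ => by positivity
  simp only [this]
  rw [lintegral_finsetSum _ fun j _ => by fun_prop]
  calc ∑ j, ∫⁻ z in E, ENNReal.ofReal ‖z - a j‖⁻¹
      ≤ ∑ _j : Fin n, ENNReal.ofReal (2 * Real.pi * δ + η / δ) := by
        refine Finset.sum_le_sum fun j _ => (setLIntegral_inv_norm_sub_le (a j) E hδ).trans ?_
        rw [ENNReal.ofReal_add (by positivity) (by positivity), div_eq_inv_mul,
          ENNReal.ofReal_mul (p := δ⁻¹) (by positivity)]
        gcongr
    _ = _ := by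
        rw [Finset.sum_const, Finset.card_univ, Fintype.card_fin, nsmul_eq_mul,
          ENNReal.ofReal_mul (by positivity), ENNReal.ofReal_natCast]

/-! ### The good set and the local area estimate. -/

/-- The exceptional set, where the polar sum is large (Markov) or a zero is near, has area at most
`η` and carries at most `A / 512` of the integral of `L`. Points with `L < A / 128` carry little
too, as the disc is small. The rest lies in the good set, where `L ≤ (l + 52 C) A`, so that set
cannot be small. -/
theorem volume_good_set_ge {L : ℂ → ℝ} (hL : Measurable L) {A C η δ l r : ℝ}
    (hA : 0 < A) (hC : 0 < C) (hη : 0 < η) (hδ : 0 < δ) (hl : 0 < l) (hr : 0 < r)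
    (h1 : 2 * C * (2 * Real.pi * δ) ≤ 1 / 1536) (h2 : 2 * C * (η / δ) ≤ 1 / 1536)
    (h3 : 52 * C * η ≤ 1 / 1536) (h4 : 2 * C * 3 / l ≤ η / 2)
    (h5 : 2 * C * A * (Real.pi * (2 * r) ^ 2) ≤ η / 2)
    {n : ℕ} {a : Fin n → ℂ} (hn : (n : ℝ) ≤ 2 * C * A)
    (hle : ∀ z ∈ Metric.ball (0 : ℂ) (1 / 8), L z ≤ (∑ j, ‖z - a j‖⁻¹) + 52 * C * A)
    (hint : ENNReal.ofReal (A / 128) ≤ ∫⁻ z in Metric.ball (0 : ℂ) (1 / 8), ENNReal.ofReal (L z)) :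
    ENNReal.ofReal (1 / (256 * (l + 52 * C))) ≤ volume {z ∈ Metric.ball (0 : ℂ) (1 / 8) |
      A / 128 ≤ L z ∧ (∑ j, ‖z - a j‖⁻¹) ≤ l * A ∧ ∀ j, 2 * r ≤ ‖z - a j‖} := by
  have hpi := Real.pi_pos
  have hpi4 := Real.pi_lt_four
  set D : Set ℂ := Metric.ball (0 : ℂ) (1 / 8) with hD
  have hDm : MeasurableSet D := Metric.isOpen_ball.measurableSet
  have hDv : volume D = ENNReal.ofReal (Real.pi / 64) := by
    rw [hD, volume_ball_eq_ofReal _ (by norm_num)]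
    congr 1; ring
  set P : ℂ → ℝ := fun z => ∑ j, ‖z - a j‖⁻¹ with hP
  have hPm : Measurable P := by rw [hP]; fun_prop
  set E₁ : Set ℂ := D ∩ {z | l * A ≤ P z} with hE₁
  set E₂ : Set ℂ := ⋃ j, Metric.ball (a j) (2 * r) with hE₂
  have hE₁m : MeasurableSet E₁ := hDm.inter (measurableSet_le measurable_const hPm)
  have hE₂m : MeasurableSet E₂ := MeasurableSet.iUnion fun j => Metric.isOpen_ball.measurableSet
  have hE₁v : volume E₁ ≤ ENNReal.ofReal (η / 2) := by
    have hc := mul_meas_ge_le_lintegral (μ := volume.restrict D) hPm.ennreal_ofReal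
      (ENNReal.ofReal (l * A))
    have hi := setLIntegral_sum_inv_norm_sub_le a (E := D) (δ := 1 / 8) (by norm_num)
      (by positivity) hDv.le
    have hs : {z | ENNReal.ofReal (l * A) ≤ ENNReal.ofReal (P z)} = {z | l * A ≤ P z} := by
      ext z
      exact ENNReal.ofReal_le_ofReal_iff (Finset.sum_nonneg fun j _ => by positivity)
    rw [hs, Measure.restrict_apply' hDm, Set.inter_comm] at hc
    have hd : volume E₁ ≤ ENNReal.ofReal (n * (2 * Real.pi * (1 / 8) + Real.pi / 64 / (1 / 8))) /
        ENNReal.ofReal (l * A) := by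
      rw [ENNReal.le_div_iff_mul_le (by left; simp; positivity) (by simp), mul_comm]
      exact hc.trans hi
    refine hd.trans ?_
    rw [← ENNReal.ofReal_div_of_pos (by positivity)]
    refine ENNReal.ofReal_le_ofReal (le_trans ?_ h4)
    rw [div_le_div_iff₀ (by positivity) hl]
    have : n * (2 * Real.pi * (1 / 8) + Real.pi / 64 / (1 / 8)) ≤ 2 * C * A * 3 := by
      gcongr
      linarith
    nlinarith
  have hE₂v : volume E₂ ≤ ENNReal.ofReal (η / 2) := by
    calc volume E₂ ≤ ∑ j, volume (Metric.ball (a j) (2 * r)) := measure_iUnion_fintype_le _ _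
      _ = ENNReal.ofReal (n * (Real.pi * (2 * r) ^ 2)) := by
        simp only [volume_ball_eq_ofReal _ (by positivity : 0 ≤ 2 * r)]
        rw [Finset.sum_const, Finset.card_univ, Fintype.card_fin, nsmul_eq_mul,
          ENNReal.ofReal_mul (p := (n : ℝ)) (by positivity), ENNReal.ofReal_natCast]
      _ ≤ ENNReal.ofReal (η / 2) := by
        refine ENNReal.ofReal_le_ofReal (le_trans ?_ h5)
        gcongr
  set E : Set ℂ := D ∩ (E₁ ∪ E₂) with hE
  have hEm : MeasurableSet E := hDm.inter (hE₁m.union hE₂m)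
  have hEv : volume E ≤ ENNReal.ofReal η := by
    refine (measure_mono Set.inter_subset_right).trans ((measure_union_le _ _).trans ?_)
    refine (add_le_add hE₁v hE₂v).trans_eq ?_
    rw [← ENNReal.ofReal_add (by positivity) (by positivity)]
    congr 1; ring
  have hPnn : ∀ z, 0 ≤ P z := fun z => Finset.sum_nonneg fun j _ => by positivity
  have hEint : ∫⁻ z in E, ENNReal.ofReal (L z) ≤ ENNReal.ofReal (A / 512) := by
    calc ∫⁻ z in E, ENNReal.ofReal (L z)
        ≤ ∫⁻ z in E, (ENNReal.ofReal (P z) + ENNReal.ofReal (52 * C * A)) := by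
          refine setLIntegral_mono' hEm fun z hz => ?_
          rw [← ENNReal.ofReal_add (hPnn z) (by positivity)]
          exact ENNReal.ofReal_le_ofReal (hle z hz.1)
      _ = (∫⁻ z in E, ENNReal.ofReal (P z)) + ENNReal.ofReal (52 * C * A) * volume E := by
          rw [lintegral_add_right _ measurable_const, setLIntegral_const]
      _ ≤ ENNReal.ofReal (n * (2 * Real.pi * δ + η / δ)) +
            ENNReal.ofReal (52 * C * A) * ENNReal.ofReal η := by
          gcongr
          exact setLIntegral_sum_inv_norm_sub_le a hδ hη.le hEv
      _ ≤ ENNReal.ofReal (A / 512) := by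
          rw [← ENNReal.ofReal_mul (by positivity),
            ← ENNReal.ofReal_add (by positivity) (by positivity)]
          refine ENNReal.ofReal_le_ofReal ?_
          have q1 : n * (2 * Real.pi * δ + η / δ) ≤ 2 * C * A * (2 * Real.pi * δ + η / δ) := by
            gcongr
          have q2 := mul_le_mul_of_nonneg_left h1 hA.le
          have q3 := mul_le_mul_of_nonneg_left h2 hA.le
          have q4 := mul_le_mul_of_nonneg_left h3 hA.le
          linarith
  set G : Set ℂ := {z ∈ D | A / 128 ≤ L z ∧ P z ≤ l * A ∧ ∀ j, 2 * r ≤ ‖z - a j‖} with hG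
  have hGm : MeasurableSet G := by
    have e : G = D ∩ ({z | A / 128 ≤ L z} ∩ ({z | P z ≤ l * A} ∩ ⋂ j, {z | 2 * r ≤ ‖z - a j‖})) := by
      ext z; simp [hG]; tauto
    rw [e]
    refine hDm.inter ((measurableSet_le measurable_const hL).inter
      ((measurableSet_le hPm measurable_const).inter (MeasurableSet.iInter fun j => ?_)))
    exact measurableSet_le measurable_const (by fun_prop)
  have hlC : 0 < l + 52 * C := by positivity
  have hGint : ∫⁻ z in D \ E, ENNReal.ofReal (L z) ≤
      ENNReal.ofReal (A / 128) * volume D + ENNReal.ofReal ((l + 52 * C) * A) * volume G := by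
    calc ∫⁻ z in D \ E, ENNReal.ofReal (L z)
        ≤ ∫⁻ z in D \ E, (ENNReal.ofReal (A / 128) +
            G.indicator (fun _ => ENNReal.ofReal ((l + 52 * C) * A)) z) := by
          refine setLIntegral_mono' (hDm.diff hEm) fun z hz => ?_
          obtain ⟨hzD, hzE⟩ := hz
          have hz' : z ∉ E₁ ∪ E₂ := fun h => hzE ⟨hzD, h⟩
          have hz1 : P z ≤ l * A := by
            by_contra hcon
            exact hz' (Or.inl ⟨hzD, (not_le.1 hcon).le⟩)
          have hz2 : ∀ j, 2 * r ≤ ‖z - a j‖ := by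
            intro j
            by_contra hcon
            refine hz' (Or.inr (Set.mem_iUnion.2 ⟨j, ?_⟩))
            rw [mem_ball_iff_norm]
            exact not_le.1 hcon
          by_cases hzL : A / 128 ≤ L z
          · have hzG : z ∈ G := ⟨hzD, hzL, hz1, hz2⟩
            rw [Set.indicator_of_mem hzG]
            refine le_trans (ENNReal.ofReal_le_ofReal ?_) le_add_self
            have := hle z hzD
            linarith
          · exact le_trans (ENNReal.ofReal_le_ofReal (not_le.1 hzL).le) le_self_add
      _ ≤ ∫⁻ z in D, (ENNReal.ofReal (A / 128) +
            G.indicator (fun _ => ENNReal.ofReal ((l + 52 * C) * A)) z) :=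
          lintegral_mono_set Set.sdiff_subset
      _ = ENNReal.ofReal (A / 128) * volume D +
            ∫⁻ z in D, G.indicator (fun _ => ENNReal.ofReal ((l + 52 * C) * A)) z := by
          rw [lintegral_add_left measurable_const, setLIntegral_const]
      _ ≤ _ := by
          gcongr
          refine (setLIntegral_le_lintegral _ _).trans_eq ?_
          rw [lintegral_indicator hGm, setLIntegral_const]
  have hsplit : ∫⁻ z in D, ENNReal.ofReal (L z) =
      (∫⁻ z in E, ENNReal.ofReal (L z)) + ∫⁻ z in D \ E, ENNReal.ofReal (L z) := by
    rw [← lintegral_inter_add_sdiff _ D hEm, Set.inter_eq_self_of_subset_right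
      Set.inter_subset_left]
  have hGfin : volume G ≠ ⊤ := by
    refine ne_top_of_le_ne_top ?_ (measure_mono (fun z hz => hz.1 : G ⊆ D))
    rw [hDv]; exact ENNReal.ofReal_ne_top
  obtain ⟨x, hx, hxG⟩ : ∃ x : ℝ, 0 ≤ x ∧ volume G = ENNReal.ofReal x :=
    ⟨(volume G).toReal, ENNReal.toReal_nonneg, (ENNReal.ofReal_toReal hGfin).symm⟩
  have hfinal := hint.trans (hsplit.le.trans (add_le_add hEint hGint))
  rw [hDv, hxG, ← ENNReal.ofReal_mul (by positivity), ← ENNReal.ofReal_mul (by positivity),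
    ← ENNReal.ofReal_add (by positivity) (by positivity),
    ← ENNReal.ofReal_add (by positivity) (by positivity),
    ENNReal.ofReal_le_ofReal_iff (by positivity)] at hfinal
  rw [hxG]
  refine ENNReal.ofReal_le_ofReal ?_
  rw [div_le_iff₀ (by positivity)]
  -- Since `π < 4`, what remains is at least `A / 128 - A / 512 - A / 2048 > A / 256`.
  have q : A * 1 ≤ A * (x * (256 * (l + 52 * C))) := by nlinarith
  exact le_of_mul_le_mul_left q hA

theorem volume_preimage_sector_unit_disc_ge {C : ℝ} (hC : 0 < C) :
    ∃ c : ℝ, 0 < c ∧ ∃ A₀ : ℝ, 0 < A₀ ∧ ∀ A : ℝ, A₀ ≤ A → ∀ g : ℂ → ℂ, Differentiable ℂ g →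
      g 0 = 1 → (∀ z ∈ Metric.closedBall (0 : ℂ) 1, ‖g z‖ ≤ Real.exp (C * A)) →
      (∀ t : ℝ, 0 < t → t < 1 → ‖g (-t)‖ ≤ Real.exp (-(A * t))) →
      ∀ θ₁ θ₂ : ℝ, θ₂ ≤ θ₁ + 2 * Real.pi →
        ENNReal.ofReal (c * (θ₂ - θ₁)) ≤
          volume (g ⁻¹' sector θ₁ θ₂ ∩ Metric.ball (0 : ℂ) (1 / 4)) := by
  have hpi := Real.pi_pos
  obtain ⟨δ, hδ, h1⟩ : ∃ δ : ℝ, 0 < δ ∧ 2 * C * (2 * Real.pi * δ) ≤ 1 / 1536 :=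
    ⟨1 / (1536 * (2 * C * (2 * Real.pi))), by positivity, le_of_eq (by field_simp)⟩
  obtain ⟨η, hη, h2, h3⟩ : ∃ η : ℝ, 0 < η ∧ 2 * C * (η / δ) ≤ 1 / 1536 ∧
      52 * C * η ≤ 1 / 1536 := by
    refine ⟨min (δ / (1536 * (2 * C))) (1 / (1536 * (52 * C))), by positivity, ?_, ?_⟩
    · calc 2 * C * (min (δ / (1536 * (2 * C))) (1 / (1536 * (52 * C))) / δ)
          ≤ 2 * C * ((δ / (1536 * (2 * C))) / δ) := by gcongr; exact min_le_left _ _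
        _ = 1 / 1536 := by field_simp
    · calc 52 * C * min (δ / (1536 * (2 * C))) (1 / (1536 * (52 * C)))
          ≤ 52 * C * (1 / (1536 * (52 * C))) := by gcongr; exact min_le_right _ _
        _ = 1 / 1536 := by field_simp
  obtain ⟨l, hl, h4⟩ : ∃ l : ℝ, 0 < l ∧ 2 * C * 3 / l ≤ η / 2 :=
    ⟨12 * C / η, by positivity, le_of_eq (by field_simp; norm_num)⟩
  -- The factor 2 allows for distances to zeros halving within the disc of radius `r`; the 1 ensures
  -- `A / 128 ≤ Λ * A`.
  set Λ : ℝ := 2 * l + 52 * C + 1 with hΛ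
  have hΛ0 : 0 < Λ := by positivity
  -- Chosen so that `r = K / A` gives equality in `256 * (Λ * A) ≤ r * (A / 128) ^ 2`.
  set K : ℝ := 256 * 128 ^ 2 * Λ with hK
  have hK0 : 0 < K := by positivity
  -- The constant is `(Λ A)⁻²` times the area of the good set over `π (K / A)²`; the powers of `A`
  -- cancel. The two lower bounds for `A` make the discs about zeros negligible and give `r ≤ 1 /
  -- 8`.
  refine ⟨1 / (Λ ^ 2 * (256 * (l + 52 * C)) * (Real.pi * K ^ 2)), by positivity,
    max (16 * Real.pi * C * K ^ 2 / η) (8 * K), by positivity, ?_⟩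
  intro A hA g hg hg0 hgC hgA θ₁ θ₂ hθ
  have hA1 : 16 * Real.pi * C * K ^ 2 / η ≤ A := (le_max_left _ _).trans hA
  have hA2 : 8 * K ≤ A := (le_max_right _ _).trans hA
  have hA0 : 0 < A := by linarith
  set r : ℝ := K / A with hr
  have hr0 : 0 < r := by positivity
  have hr8 : r ≤ 1 / 8 := by rw [hr, div_le_iff₀ hA0]; linarith
  have h5 : 2 * C * A * (Real.pi * (2 * r) ^ 2) ≤ η / 2 := by
    rw [div_le_iff₀ hη] at hA1
    have e : 2 * C * A * (Real.pi * (2 * r) ^ 2) = (16 * Real.pi * C * K ^ 2) / (2 * A) := by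
      rw [hr]; field_simp; norm_num
    rw [e, div_le_iff₀ (by positivity)]
    linarith
  obtain ⟨n, a, hn, hne, hle⟩ := exists_norm_logDeriv_le hg (by positivity : 0 < C * A) hgC hg0
  have hsub : Metric.ball (0 : ℂ) (1 / 8) ⊆ Metric.ball 0 (1 / 4) :=
    Metric.ball_subset_ball (by norm_num)
  have hgd : Continuous (deriv g) := (hg.contDiff (n := 1)).continuous_deriv le_rfl
  have hmeas : Measurable fun z => ‖deriv g z / g z‖ :=
    (hgd.measurable.div hg.continuous.measurable).norm
  have hint : ENNReal.ofReal (A / 128) ≤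
      ∫⁻ z in Metric.ball (0 : ℂ) (1 / 8), ENNReal.ofReal ‖deriv g z / g z‖ := by
    have := lintegral_ball_logDeriv_ge hg hg0 hA0.le (by norm_num : (0 : ℝ) < 1 / 8)
      (fun t ht ht' => hgA t ht (by linarith)) (fun z hz => hne z (hsub hz))
    convert this using 2
    ring
  have hG := volume_good_set_ge hmeas hA0 hC hη hδ hl hr0 h1 h2 h3 h4 h5
    (by linarith) (fun z hz => (hle z (hsub hz)).trans_eq (by ring)) hint
  set G : Set ℂ := {z ∈ Metric.ball (0 : ℂ) (1 / 8) |
      A / 128 ≤ ‖deriv g z / g z‖ ∧ (∑ j, ‖z - a j‖⁻¹) ≤ l * A ∧ ∀ j, 2 * r ≤ ‖z - a j‖} with hGdef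
  set U : Set ℂ := g ⁻¹' sector θ₁ θ₂ ∩ Metric.ball (0 : ℂ) (1 / 4) with hU
  have hUm : MeasurableSet U :=
    ((isOpen_sector θ₁ θ₂).preimage hg.continuous).measurableSet.inter
      Metric.isOpen_ball.measurableSet
  have hloc : ∀ z ∈ G, ENNReal.ofReal ((θ₂ - θ₁) / (Λ * A) ^ 2) ≤ volume (U ∩ Metric.ball z r) := by
    rintro z ⟨hz, hzL, hzP, hza⟩
    have hz8 : ‖z‖ < 1 / 8 := by simpa using hz
    have hbsub : Metric.ball z r ⊆ Metric.ball 0 (1 / 4) := by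
      refine Metric.ball_subset_ball' ?_
      rw [dist_zero_right]; linarith
    have hhalf : ∀ w ∈ Metric.ball z r, ∀ j, ‖z - a j‖ / 2 ≤ ‖w - a j‖ := by
      intro w hw j
      rw [mem_ball_iff_norm] at hw
      have e : z - a j = (w - a j) - (w - z) := by ring
      have := norm_sub_le (w - a j) (w - z)
      rw [← e] at this
      linarith [hza j]
    have hpos : ∀ j, 0 < ‖z - a j‖ := fun j => by linarith [hza j]
    have hb := volume_preimage_sector_ball_ge (z := z) (R := r) (c := A / 128) (Λ := Λ * A) hg hr0
      (by positivity)
      (by rw [div_le_iff₀ (by norm_num)]; nlinarith)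
      (le_of_eq (by rw [hr, hK]; field_simp))
      (fun w hw => hne w (hbsub hw) fun j hj => by
        have h6 := hhalf w hw j
        rw [hj, sub_self, norm_zero] at h6
        linarith [hpos j])
      (fun w hw => by
        refine (hle w (hbsub hw)).trans ?_
        have h7 : ∑ j, ‖w - a j‖⁻¹ ≤ ∑ j, 2 * ‖z - a j‖⁻¹ := by
          refine Finset.sum_le_sum fun j _ => ?_
          have h8 := inv_anti₀ (by linarith [hpos j]) (hhalf w hw j)
          rwa [inv_div, div_eq_mul_inv] at h8
        rw [← Finset.mul_sum] at h7
        rw [hΛ]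
        linarith) hzL hθ
    refine hb.trans (measure_mono ?_)
    rintro w ⟨hw1, hw2⟩
    exact ⟨⟨hw1, hbsub hw2⟩, hw2⟩
  have hmain := measure_mul_le_of_forall_le_ball hUm hloc
  have hmain2 := (mul_le_mul_right hG (ENNReal.ofReal ((θ₂ - θ₁) / (Λ * A) ^ 2))).trans hmain
  rw [volume_ball_eq_ofReal _ hr0.le, mul_comm, ← ENNReal.ofReal_mul (by positivity)] at hmain2
  have hne0 : ENNReal.ofReal (Real.pi * r ^ 2) ≠ 0 := by simpa using by positivity
  rw [← ENNReal.div_le_iff_le_mul (Or.inl hne0) (Or.inl ENNReal.ofReal_ne_top),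
    ← ENNReal.ofReal_div_of_pos (by positivity)] at hmain2
  refine le_of_eq_of_le ?_ hmain2
  congr 1
  rw [hr]
  field_simp

/-! ### Maximum modulus, convexity and order. -/

theorem bddAbove_norm_image_closedBall {f : ℂ → ℂ} (hf : Differentiable ℂ f) (r : ℝ) :
    BddAbove ((fun z => ‖f z‖) '' Metric.closedBall (0 : ℂ) r) :=
  (isCompact_closedBall 0 r).bddAbove_image hf.continuous.norm.continuousOn

theorem norm_le_maxModulus {f : ℂ → ℂ} (hf : Differentiable ℂ f) {z : ℂ} {r : ℝ} (hz : ‖z‖ ≤ r) :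
    ‖f z‖ ≤ maxModulus f r :=
  le_csSup (bddAbove_norm_image_closedBall hf r) ⟨z, by simpa using hz, rfl⟩

theorem exists_norm_eq_maxModulus {f : ℂ → ℂ} (hf : Differentiable ℂ f) {r : ℝ} (hr : 0 < r) :
    ∃ w : ℂ, ‖w‖ = r ∧ ‖f w‖ = maxModulus f r := by
  obtain ⟨w, hw, hmax⟩ := Complex.exists_mem_frontier_isMaxOn_norm (f := f)
    (Metric.isBounded_ball (x := (0 : ℂ)) (r := r)) (by simpa using hr) hf.diffContOnCl
  rw [frontier_ball _ hr.ne'] at hw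
  have hwr : ‖w‖ = r := by simpa using hw
  refine ⟨w, hwr, le_antisymm (norm_le_maxModulus hf hwr.le) ?_⟩
  refine csSup_le ⟨_, w, by simp [hwr], rfl⟩ ?_
  rintro _ ⟨z, hz, rfl⟩
  refine hmax ?_
  rwa [closure_ball _ hr.ne']

theorem maxModulus_pos {f : ℂ → ℂ} (hf : Differentiable ℂ f) (hne : ∃ z, f z ≠ 0) {r : ℝ}
    (hr : 0 < r) : 0 < maxModulus f r := by
  by_contra hcon
  obtain ⟨z₁, hz₁⟩ := hne
  refine hz₁ ?_
  have hev : f =ᶠ[𝓝 0] fun _ => 0 := by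
    filter_upwards [Metric.closedBall_mem_nhds (0 : ℂ) hr] with z hz
    have := norm_le_maxModulus hf (z := z) (r := r) (by simpa using hz)
    exact norm_le_zero_iff.1 (this.trans (not_lt.1 hcon))
  have han : AnalyticOnNhd ℂ f Set.univ := fun z _ => hf.analyticAt z
  exact congrFun (han.eq_of_eventuallyEq (fun z _ => analyticAt_const) hev) z₁

theorem maxModulus_mono {f : ℂ → ℂ} (hf : Differentiable ℂ f) {r s : ℝ} (hr : 0 < r)
    (hrs : r ≤ s) : maxModulus f r ≤ maxModulus f s := by
  obtain ⟨w, hw, hw'⟩ := exists_norm_eq_maxModulus hf hr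
  rw [← hw']
  exact norm_le_maxModulus hf (hw.le.trans hrs)

theorem log_maxModulus_exp_monotone {f : ℂ → ℂ} (hf : Differentiable ℂ f) (hne : ∃ z, f z ≠ 0) :
    Monotone fun x : ℝ => Real.log (maxModulus f (Real.exp x)) := fun _ _ hxy =>
  Real.log_le_log (maxModulus_pos hf hne (Real.exp_pos _))
    (maxModulus_mono hf (Real.exp_pos _) (Real.exp_le_exp.2 hxy))

/-- Hadamard's three circles theorem. -/
theorem convexOn_log_maxModulus_exp {f : ℂ → ℂ} (hf : Differentiable ℂ f) (hne : ∃ z, f z ≠ 0) :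
    ConvexOn ℝ Set.univ fun x : ℝ => Real.log (maxModulus f (Real.exp x)) := by
  refine LinearOrder.convexOn_of_lt convex_univ ?_
  intro x _ y _ hxy a b ha hb hab
  simp only [smul_eq_mul]
  obtain ⟨w, hw, hfw⟩ := exists_norm_eq_maxModulus hf (Real.exp_pos (a * x + b * y))
  have hMx := maxModulus_pos hf hne (Real.exp_pos x)
  have hMy := maxModulus_pos hf hne (Real.exp_pos y)
  have hw0 : w ≠ 0 := by
    rw [← norm_pos_iff, hw]; exact Real.exp_pos _
  have hre : (Complex.log w).re = a * x + b * y := by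
    rw [Complex.log_re, hw, Real.log_exp]
  have hb' : b = 1 - a := by linarith
  have h1 : x ≤ a * x + b * y := by rw [hb']; nlinarith
  have h2 : a * x + b * y ≤ y := by rw [hb']; nlinarith
  -- Composition with `exp` turns circles into vertical lines, so the three lines theorem applies.
  have key := Complex.HadamardThreeLines.norm_le_interp_of_mem_verticalClosedStrip'
    (f := fun z => f (Complex.exp z)) (z := Complex.log w) (l := x) (u := y)
    (a := maxModulus f (Real.exp x)) (b := maxModulus f (Real.exp y)) hxy
    (by
      simp only [Complex.HadamardThreeLines.verticalClosedStrip, Set.mem_preimage, hre, Set.mem_Icc]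
      exact ⟨h1, h2⟩)
    (hf.comp Complex.differentiable_exp).diffContOnCl
    (by
      refine ⟨maxModulus f (Real.exp y), ?_⟩
      rintro _ ⟨z, hz, rfl⟩
      refine norm_le_maxModulus hf ?_
      rw [Complex.norm_exp]
      exact Real.exp_le_exp.2 hz.2)
    (fun z hz => norm_le_maxModulus hf (by rw [Complex.norm_exp]; exact le_of_eq (congrArg _ hz)))
    (fun z hz => norm_le_maxModulus hf (by rw [Complex.norm_exp]; exact le_of_eq (congrArg _ hz)))
  have hs : (a * x + b * y - x) / (y - x) = b := by
    rw [div_eq_iff (by linarith)]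
    have : a = 1 - b := by linarith
    rw [this]; ring
  rw [hre, hs, Complex.exp_log hw0, hfw, show 1 - b = a by linarith] at key
  have := Real.log_le_log (maxModulus_pos hf hne (Real.exp_pos _)) key
  rwa [Real.log_mul (Real.rpow_pos_of_pos hMx _).ne' (Real.rpow_pos_of_pos hMy _).ne',
    Real.log_rpow hMx, Real.log_rpow hMy] at this

theorem exists_ne_zero_of_growthOrder {f : ℂ → ℂ} {ρ : ℝ} (hρ : 0 < ρ)
    (h : growthOrder f = (ρ : EReal)) : ∃ z, f z ≠ 0 := by
  by_contra! hcon
  have hM : ∀ r, Real.log (maxModulus f r) = 0 := by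
    intro r
    have : maxModulus f r = 0 := by
      unfold maxModulus
      simp only [hcon, norm_zero]
      by_cases hr : (Metric.closedBall (0 : ℂ) r).Nonempty
      · rw [hr.image_const]; simp
      · rw [Set.not_nonempty_iff_eq_empty.1 hr]; simp
    rw [this, Real.log_zero]
  unfold growthOrder at h
  simp only [hM, Real.log_zero, zero_div, EReal.coe_zero, limsup_const] at h
  have : (0 : ℝ) = ρ := by exact_mod_cast h
  linarith

theorem eventually_log_maxModulus_exp_le {f : ℂ → ℂ} {ρ : ℝ}
    (h : growthOrder f = (ρ : EReal)) :
    ∀ᶠ x : ℝ in atTop, Real.log (maxModulus f (Real.exp x)) ≤ Real.exp ((ρ + 1) * x) := by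
  have h1 : growthOrder f < ((ρ + 1 : ℝ) : EReal) := by
    rw [h]; exact_mod_cast lt_add_one ρ
  have h2 := Real.tendsto_exp_atTop.eventually (eventually_lt_of_limsup_lt h1)
  filter_upwards [h2, eventually_gt_atTop 0] with x hx hx0
  rcases le_or_gt (Real.log (maxModulus f (Real.exp x))) 0 with hneg | hpos
  · exact hneg.trans (Real.exp_pos _).le
  · have hx' := EReal.coe_lt_coe_iff.1 hx
    rw [Real.log_exp, div_lt_iff₀ hx0] at hx'
    exact ((Real.log_lt_iff_lt_exp hpos).1 hx').le

theorem frequently_lt_log_maxModulus_exp {f : ℂ → ℂ} (hf : Differentiable ℂ f) {ρ : ℝ} (hρ : 0 < ρ)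
    (h : growthOrder f = (ρ : EReal)) (X : ℝ) :
    ∃ x : ℝ, X ≤ x ∧ Real.exp (ρ / 2 * x) < Real.log (maxModulus f (Real.exp x)) := by
  have hne := exists_ne_zero_of_growthOrder hρ h
  have h1 : ((ρ / 2 : ℝ) : EReal) < growthOrder f := by
    rw [h]; exact_mod_cast half_lt_self hρ
  have h2 := frequently_lt_of_lt_limsup (by isBoundedDefault) h1
  set Y : ℝ := max (max X 1) (2 / ρ * |Real.log (maxModulus f (Real.exp 0))|) with hY
  obtain ⟨r, hr, hrY⟩ := (h2.and_eventually (eventually_ge_atTop (Real.exp Y))).exists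
  have hr0 : 0 < r := (Real.exp_pos _).trans_le hrY
  have hx : Y ≤ Real.log r := (Real.le_log_iff_exp_le hr0).2 hrY
  have hxX : X ≤ Real.log r := ((le_max_left _ _).trans (le_max_left _ _)).trans hx
  have hx1 : 1 ≤ Real.log r := ((le_max_right _ _).trans (le_max_left _ _)).trans hx
  have hx2 : 2 / ρ * |Real.log (maxModulus f (Real.exp 0))| ≤ Real.log r :=
    (le_max_right _ _).trans hx
  refine ⟨Real.log r, hxX, ?_⟩
  have hr' := EReal.coe_lt_coe_iff.1 hr
  rw [lt_div_iff₀ (by linarith)] at hr'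
  rw [Real.exp_log hr0]
  have hL0 : Real.log (maxModulus f r) ≠ 0 := by
    intro h0
    rw [h0, Real.log_zero] at hr'
    have : 0 < ρ / 2 * Real.log r := by positivity
    linarith
  rw [← Real.log_abs (Real.log (maxModulus f r)), Real.lt_log_iff_exp_lt (abs_pos.2 hL0)] at hr'
  -- `Real.log` is even, so a very negative `log M` would also make `log log M` large. Monotonicity
  -- keeps `log M` above its value at radius 1, and the last entry of `Y` then rules this out.
  rcases le_or_gt 0 (Real.log (maxModulus f r)) with hpos | hneg
  · rwa [abs_of_nonneg hpos] at hr'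
  · exfalso
    have hmono := log_maxModulus_exp_monotone hf hne (by linarith : (0 : ℝ) ≤ Real.log r)
    simp only [Real.exp_log hr0] at hmono
    rw [abs_of_neg hneg] at hr'
    have h3 := neg_abs_le (Real.log (maxModulus f (Real.exp 0)))
    have h4 := Real.add_one_le_exp (ρ / 2 * Real.log r)
    have h5 : |Real.log (maxModulus f (Real.exp 0))| ≤ ρ / 2 * Real.log r := by
      have := mul_le_mul_of_nonneg_left hx2 (by positivity : 0 ≤ ρ / 2)
      refine le_of_eq_of_le ?_ this
      field_simp
    linarith

/-! ### Selecting regular steps of a convex function. -/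

theorem monotone_increments_of_convexOn {φ : ℝ → ℝ} (hφ : ConvexOn ℝ Set.univ φ) {N : ℕ}
    (hN : 0 < N) : Monotone fun k : ℕ => φ ((k + 1 : ℝ) / N) - φ ((k : ℝ) / N) := by
  refine monotone_nat_of_le_succ fun k => ?_
  have hN' : (0 : ℝ) < N := by exact_mod_cast hN
  have h := hφ.slope_mono_adjacent (x := (k : ℝ) / N) (y := (k + 1 : ℝ) / N)
    (z := (k + 1 + 1 : ℝ) / N) trivial trivial (by gcongr; linarith) (by gcongr; linarith)
  have e1 : (k + 1 : ℝ) / N - (k : ℝ) / N = 1 / N := by ring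
  have e2 : (k + 1 + 1 : ℝ) / N - (k + 1 : ℝ) / N = 1 / N := by ring
  rw [e1, e2, div_le_div_iff_of_pos_right (by positivity)] at h
  push_cast
  exact h

/-- Bounded increments would make `φ` grow at most linearly, against the exponential lower bound
along a sequence. -/
theorem exists_increment_ge {φ : ℝ → ℝ} (hmono : Monotone φ) {N : ℕ} (hN : 0 < N)
    (hinc : Monotone fun k : ℕ => φ ((k + 1 : ℝ) / N) - φ ((k : ℝ) / N)) {b : ℝ} (hb : 0 < b)
    (hlow : ∀ X : ℝ, ∃ x, X ≤ x ∧ Real.exp (b * x) < φ x) (T : ℝ) :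
    ∃ k₀ : ℕ, ∀ k ≥ k₀, T ≤ φ ((k + 1 : ℝ) / N) - φ ((k : ℝ) / N) := by
  by_contra! hcon
  have hN' : (0 : ℝ) < N := by exact_mod_cast hN
  have hT : ∀ k : ℕ, φ ((k + 1 : ℝ) / N) - φ ((k : ℝ) / N) < T := by
    intro k
    obtain ⟨l, hl, hlT⟩ := hcon k
    exact (hinc hl).trans_lt hlT
  have hlin : ∀ k : ℕ, φ ((k : ℝ) / N) ≤ φ 0 + k * T := by
    intro k
    induction k with
    | zero => simp
    | succ k ih =>
      have := hT k
      push_cast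
      linarith
  have hT0 : 0 < T := by
    refine lt_of_le_of_lt ?_ (hT 0)
    exact sub_nonneg.2 (hmono (by gcongr; linarith))
  set S : ℝ := |φ 0| + (N + 1) * T with hS
  obtain ⟨x, hx, hφx⟩ := hlow (max 1 (2 * S / b ^ 2))
  have hx1 : 1 ≤ x := (le_max_left _ _).trans hx
  have hx2 : 2 * S / b ^ 2 ≤ x := (le_max_right _ _).trans hx
  rw [div_le_iff₀ (by positivity)] at hx2
  have h1 : φ x ≤ φ ((⌈x * N⌉₊ : ℝ) / N) := by
    refine hmono ?_
    rw [le_div_iff₀ hN']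
    exact Nat.le_ceil _
  have h2 : (⌈x * N⌉₊ : ℝ) < x * N + 1 := Nat.ceil_lt_add_one (by positivity)
  have h3 := hlin ⌈x * N⌉₊
  have h4 : (⌈x * N⌉₊ : ℝ) * T ≤ (x * N + 1) * T := by gcongr
  have h5 := Real.quadratic_le_exp_of_nonneg (by positivity : 0 ≤ b * x)
  have h6 : φ 0 ≤ |φ 0| * x := (le_abs_self _).trans (le_mul_of_one_le_right (abs_nonneg _) hx1)
  have h7 : (x * N + 1) * T ≤ (N + 1) * T * x := by nlinarith
  have h8 : S * x ≤ (b * x) ^ 2 / 2 := by nlinarith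
  have h9 : 0 ≤ b * x := by positivity
  have h10 : S * x = |φ 0| * x + (N + 1) * T * x := by rw [hS]; ring
  linarith

theorem exists_increment_ratio_le {φ : ℝ → ℝ} (hmono : Monotone φ) {N : ℕ} (hN : 0 < N) {ρ : ℝ}
    (hρN : ρ + 2 ≤ 3 * N)
    (hup : ∀ᶠ x : ℝ in atTop, φ x ≤ Real.exp ((ρ + 1) * x)) {m₀ : ℕ}
    (hpos : 1 ≤ φ ((m₀ + 1 : ℝ) / N) - φ ((m₀ : ℝ) / N)) :
    ∃ m : ℕ, m₀ ≤ m ∧ φ (((m + N : ℕ) + 1 : ℝ) / N) - φ (((m + N : ℕ) : ℝ) / N) ≤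
      Real.exp (3 * N) * (φ ((m + 1 : ℝ) / N) - φ ((m : ℝ) / N)) := by
  by_contra! hcon
  have hN' : (0 : ℝ) < N := by exact_mod_cast hN
  have hgrow : ∀ j : ℕ, Real.exp (3 * N * j) ≤
      φ (((m₀ + j * N : ℕ) + 1 : ℝ) / N) - φ (((m₀ + j * N : ℕ) : ℝ) / N) := by
    intro j
    induction j with
    | zero => simpa using hpos
    | succ j ih =>
      have h := hcon (m₀ + j * N) (Nat.le_add_right _ _)
      have e : m₀ + (j + 1) * N = m₀ + j * N + N := by ring
      rw [e]
      refine le_trans ?_ h.le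
      rw [show (3 * N * ((j + 1 : ℕ) : ℝ)) = 3 * N + 3 * N * j by push_cast; ring, Real.exp_add]
      gcongr
  set d : ℝ := (m₀ + 1 : ℝ) / N with hd
  have htend : Tendsto (fun j : ℕ => (j : ℝ) + d) atTop atTop :=
    tendsto_atTop_add_const_right _ _ tendsto_natCast_atTop_atTop
  have htend2 : Tendsto (fun j : ℕ => Real.exp (j : ℝ)) atTop atTop :=
    Real.tendsto_exp_atTop.comp tendsto_natCast_atTop_atTop
  obtain ⟨j, hj1, hj2⟩ := ((htend.eventually hup).and
    (htend2.eventually (eventually_gt_atTop (Real.exp ((|ρ| + 1) * d) + |φ 0|)))).exists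
  have h1 := hgrow j
  have e1 : ((m₀ + j * N : ℕ) + 1 : ℝ) / N = j + d := by
    rw [hd]; push_cast; field_simp; ring
  rw [e1] at h1
  have h2 : φ 0 ≤ φ (((m₀ + j * N : ℕ) : ℝ) / N) := hmono (by positivity)
  have hd0 : 0 ≤ d := by positivity
  have hj0 : (0 : ℝ) ≤ j := Nat.cast_nonneg j
  have h3 : Real.exp ((ρ + 1) * (j + d)) ≤
      Real.exp ((|ρ| + 1) * d) * Real.exp ((3 * N - 1) * j) := by
    rw [← Real.exp_add]
    refine Real.exp_le_exp.2 ?_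
    have q1 : (ρ + 1) * d ≤ (|ρ| + 1) * d := by gcongr; exact le_abs_self ρ
    have q2 : (ρ + 1) * j ≤ (3 * N - 1) * j := by gcongr; linarith
    linarith
  have h4 : 1 ≤ Real.exp ((3 * N - 1) * j) := by
    refine Real.one_le_exp (mul_nonneg ?_ hj0)
    have : (1 : ℝ) ≤ N := by exact_mod_cast hN
    linarith
  have h5 : -φ 0 ≤ |φ 0| * Real.exp ((3 * N - 1) * j) :=
    (neg_le_abs _).trans (le_mul_of_one_le_right (abs_nonneg _) h4)
  have h6 : Real.exp (3 * N * j) = Real.exp j * Real.exp ((3 * N - 1) * j) := by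
    rw [← Real.exp_add]; congr 1; ring
  have h7 := mul_lt_mul_of_pos_right hj2 (Real.exp_pos ((3 * N - 1) * j))
  linarith

/-- Each bad step multiplies `Δ` by more than `e^6` and no step decreases it, so a total factor
`e^(3N)` leaves room for at most `N / 2` bad steps. -/
theorem le_two_mul_card_ratio_le {Δ : ℕ → ℝ} (hΔ : Monotone Δ) {m N : ℕ} (hpos : 0 < Δ m)
    (h : Δ (m + N) ≤ Real.exp (3 * N) * Δ m) :
    N ≤ 2 * ((Finset.range N).filter fun i => Δ (m + i + 1) ≤ Real.exp 6 * Δ (m + i)).card := by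
  have hind : ∀ n : ℕ, Real.exp (6 *
      ((Finset.range n).filter fun i => ¬ Δ (m + i + 1) ≤ Real.exp 6 * Δ (m + i)).card) * Δ m ≤
      Δ (m + n) := by
    intro n
    induction n with
    | zero => simp
    | succ n ih =>
      rw [Finset.range_add_one, Finset.filter_insert]
      split_ifs with hc
      · exact ih.trans (hΔ (by omega))
      · rw [Finset.card_insert_of_notMem (by simp)]
        push_cast
        rw [mul_add, mul_one, add_comm, Real.exp_add, mul_assoc]
        exact (mul_le_mul_of_nonneg_left ih (Real.exp_pos _).le).trans (not_le.1 hc).le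
  have h1 := (hind N).trans h
  have h2 := Real.exp_le_exp.1 (le_of_mul_le_mul_right h1 hpos)
  have h3 := Finset.card_filter_add_card_filter_not (s := Finset.range N)
    (fun i => Δ (m + i + 1) ≤ Real.exp 6 * Δ (m + i))
  rw [Finset.card_range] at h3
  have h4 : 2 * ((Finset.range N).filter fun i =>
      ¬ Δ (m + i + 1) ≤ Real.exp 6 * Δ (m + i)).card ≤ N := by
    have : (6 : ℝ) * ((Finset.range N).filter fun i =>
      ¬ Δ (m + i + 1) ≤ Real.exp 6 * Δ (m + i)).card ≤ 3 * N := h2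
    have h5 : (2 : ℝ) * ((Finset.range N).filter fun i =>
      ¬ Δ (m + i + 1) ≤ Real.exp 6 * Δ (m + i)).card ≤ N := by linarith
    exact_mod_cast h5
  omega

/-! ### Rescaling at maximum points and summing over disjoint discs. -/

theorem volume_rescaled_preimage_sector_le {f : ℂ → ℂ} (hf : Differentiable ℂ f) {z : ℂ} (hz : z ≠ 0)
    (hfz : f z ≠ 0) {η : ℝ} (hη : 0 < η) (θ₁ θ₂ : ℝ) :
    volume ((fun w => f (z + z * η * w) / f z) ⁻¹'
        sector (θ₁ - (f z).arg) (θ₂ - (f z).arg) ∩ Metric.ball (0 : ℂ) (1 / 4)) ≤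
      ENNReal.ofReal ((‖z‖ * η)⁻¹ ^ 2) *
        volume (f ⁻¹' sector θ₁ θ₂ ∩ Metric.ball z (‖z‖ * η / 4)) := by
  have hη' : (η : ℂ) ≠ 0 := by exact_mod_cast hη.ne'
  have hzη : z * η ≠ 0 := mul_ne_zero hz hη'
  have hnz : 0 < ‖z‖ := norm_pos_iff.2 hz
  have hX : MeasurableSet (f ⁻¹' sector θ₁ θ₂ ∩ Metric.ball z (‖z‖ * η / 4)) :=
    (((isOpen_sector θ₁ θ₂).preimage hf.continuous).inter Metric.isOpen_ball).measurableSet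
  refine le_trans (measure_mono ?_) (volume_image_le_of_norm_deriv_le (F := fun u => (u - z) / (z * η))
    (F' := fun _ => 1 / (z * η)) (Λ := (‖z‖ * η)⁻¹) hX
    (fun u _ => ((hasDerivAt_id' u).sub_const z).div_const (z * η)) (fun u _ => ?_))
  · rintro w ⟨hw1, hw2⟩
    refine ⟨z + z * η * w, ⟨?_, ?_⟩, by field_simp; ring⟩
    · rw [Set.mem_preimage, ← mul_mem_sector_iff (norm_pos_iff.2 hfz),
        Complex.norm_mul_exp_arg_mul_I, mul_div_cancel₀ _ hfz] at hw1
      exact hw1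
    · have hw : ‖w‖ < 1 / 4 := by simpa using hw2
      rw [mem_ball_iff_norm, add_sub_cancel_left, norm_mul, norm_mul, Complex.norm_real,
        Real.norm_of_nonneg hη.le, div_eq_mul_one_div]
      gcongr
  · rw [norm_div, norm_one, norm_mul, Complex.norm_real, Real.norm_of_nonneg hη.le, one_div]

theorem disjoint_ball_of_norm {z w : ℂ} {η : ℝ} (hη : 0 < η) (hη1 : η ≤ 1)
    (h : ‖z‖ * Real.exp η ≤ ‖w‖) :
    Disjoint (Metric.ball z (‖z‖ * η / 4)) (Metric.ball w (‖w‖ * η / 4)) := by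
  refine Metric.ball_disjoint_ball ?_
  have h1 := Real.add_one_le_exp η
  have h2 : ‖z‖ * (η + 1) ≤ ‖w‖ := (mul_le_mul_of_nonneg_left h1 (norm_nonneg z)).trans h
  have h3 := norm_sub_norm_le w z
  rw [dist_eq_norm, norm_sub_rev]
  have h4 : ‖z‖ * η ≤ ‖w‖ - ‖z‖ := by linarith
  have h5 : ‖w‖ * η = (‖w‖ - ‖z‖) * η + ‖z‖ * η := by ring
  have h7 : 0 ≤ ‖z‖ * η := by positivity
  have h6 : (‖w‖ - ‖z‖) * η ≤ ‖w‖ - ‖z‖ := mul_le_of_le_one_right (by linarith) hη1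
  linarith

theorem volume_preimage_sector_disc_ge {c A₀ : ℝ}
    (hloc : ∀ A : ℝ, A₀ ≤ A → ∀ g : ℂ → ℂ, Differentiable ℂ g →
      g 0 = 1 → (∀ z ∈ Metric.closedBall (0 : ℂ) 1, ‖g z‖ ≤ Real.exp (Real.exp 6 * A)) →
      (∀ t : ℝ, 0 < t → t < 1 → ‖g (-t)‖ ≤ Real.exp (-(A * t))) →
      ∀ θ₁ θ₂ : ℝ, θ₂ ≤ θ₁ + 2 * Real.pi →
        ENNReal.ofReal (c * (θ₂ - θ₁)) ≤
          volume (g ⁻¹' sector θ₁ θ₂ ∩ Metric.ball (0 : ℂ) (1 / 4)))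
    {f : ℂ → ℂ} (hf : Differentiable ℂ f) (hne : ∃ z, f z ≠ 0) {x η A : ℝ} (hη : 0 < η)
    (hη1 : η ≤ 1) (hA : A₀ ≤ A)
    (hleft : A = Real.log (maxModulus f (Real.exp x)) - Real.log (maxModulus f (Real.exp (x - η))))
    (hright : Real.log (maxModulus f (Real.exp (x + η))) - Real.log (maxModulus f (Real.exp x)) ≤
      Real.exp 6 * A) :
    ∃ z : ℂ, ‖z‖ = Real.exp x ∧ ∀ θ₁ θ₂ : ℝ, θ₂ ≤ θ₁ + 2 * Real.pi →
      ENNReal.ofReal (c * (θ₂ - θ₁) * (Real.exp x * η) ^ 2) ≤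
        volume (f ⁻¹' sector θ₁ θ₂ ∩ Metric.ball z (‖z‖ * η / 4)) := by
  obtain ⟨z, hz, hfz⟩ := exists_norm_eq_maxModulus hf (Real.exp_pos x)
  have hM : ∀ y : ℝ, 0 < maxModulus f (Real.exp y) := fun y => maxModulus_pos hf hne (Real.exp_pos y)
  have hz0 : z ≠ 0 := by rw [← norm_pos_iff, hz]; exact Real.exp_pos _
  have hfz0 : f z ≠ 0 := by rw [← norm_pos_iff, hfz]; exact hM x
  refine ⟨z, hz, fun θ₁ θ₂ hθ => ?_⟩
  set g : ℂ → ℂ := fun w => f (z + z * η * w) / f z with hg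
  have hgd : Differentiable ℂ g := by
    rw [hg]
    exact (hf.comp (by fun_prop : Differentiable ℂ fun w : ℂ => z + z * η * w)).div_const _
  have hbound : ∀ (w : ℂ) (y d : ℝ), ‖1 + η * w‖ ≤ Real.exp y →
      Real.log (maxModulus f (Real.exp (x + y))) - Real.log (maxModulus f (Real.exp x)) ≤ d →
      ‖g w‖ ≤ Real.exp d := by
    intro w y d hw hd
    have h1 : ‖f (z + z * η * w)‖ ≤ maxModulus f (Real.exp (x + y)) := by
      refine norm_le_maxModulus hf ?_
      rw [show z + z * η * w = z * (1 + η * w) by ring, norm_mul, hz, Real.exp_add]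
      gcongr
    rw [← Real.log_div (hM _).ne' (hM _).ne', Real.log_le_iff_le_exp (div_pos (hM _) (hM _))] at hd
    refine le_trans ?_ hd
    simp only [hg, norm_div, hfz]
    have := hM x
    gcongr
  have hconv := convexOn_log_maxModulus_exp hf hne
  have hl := hloc A hA g hgd (by simp [hg, hfz0])
    (fun w hw => by
      have hw1 : ‖w‖ ≤ 1 := by simpa using hw
      refine hbound w η _ ?_ hright
      refine (norm_add_le _ _).trans ?_
      rw [norm_one, norm_mul, Complex.norm_real, Real.norm_of_nonneg hη.le]
      have := Real.add_one_le_exp η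
      have := mul_le_of_le_one_right hη.le hw1
      linarith)
    (fun t ht ht1 => by
      refine hbound (-t) (-(η * t)) _ ?_ ?_
      · have e : (1 + η * (-t) : ℂ) = ((1 - η * t : ℝ) : ℂ) := by push_cast; ring
        have hηt : η * t ≤ 1 := by nlinarith
        rw [e, Complex.norm_real, Real.norm_of_nonneg (by linarith)]
        have := Real.add_one_le_exp (-(η * t))
        linarith
      -- The chord of `φ` over `[x - η, x]` lies above its graph, giving a drop of at least `A t` at
      -- `x - η t`.
      · have := hconv.2 (Set.mem_univ x) (Set.mem_univ (x - η)) (by linarith : 0 ≤ 1 - t) ht.le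
          (by ring)
        simp only [smul_eq_mul] at this
        rw [show (1 - t) * x + t * (x - η) = x + -(η * t) by ring] at this
        rw [hleft]
        linarith)
    (θ₁ - (f z).arg) (θ₂ - (f z).arg) (by linarith)
  have h2 := hl.trans (volume_rescaled_preimage_sector_le hf hz0 hfz0 hη θ₁ θ₂)
  rw [hz] at h2 ⊢
  have hs : 0 < Real.exp x * η := by positivity
  have h3 := mul_le_mul_right h2 (ENNReal.ofReal ((Real.exp x * η) ^ 2))
  rw [← mul_assoc, ← ENNReal.ofReal_mul (by positivity), ← ENNReal.ofReal_mul (by positivity),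
    ← mul_pow, mul_inv_cancel₀ hs.ne', one_pow, ENNReal.ofReal_one, one_mul] at h3
  refine le_of_eq_of_le ?_ h3
  congr 1
  ring

theorem exists_relArea_sector_ge {c A₀ : ℝ} (hc : 0 < c)
    (hloc : ∀ A : ℝ, A₀ ≤ A → ∀ g : ℂ → ℂ, Differentiable ℂ g →
      g 0 = 1 → (∀ z ∈ Metric.closedBall (0 : ℂ) 1, ‖g z‖ ≤ Real.exp (Real.exp 6 * A)) →
      (∀ t : ℝ, 0 < t → t < 1 → ‖g (-t)‖ ≤ Real.exp (-(A * t))) →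
      ∀ θ₁ θ₂ : ℝ, θ₂ ≤ θ₁ + 2 * Real.pi →
        ENNReal.ofReal (c * (θ₂ - θ₁)) ≤
          volume (g ⁻¹' sector θ₁ θ₂ ∩ Metric.ball (0 : ℂ) (1 / 4)))
    {ρ : ℝ} (hρ : 0 < ρ) {f : ℂ → ℂ} (hf : Differentiable ℂ f)
    (hord : growthOrder f = (ρ : EReal)) (R : ℝ) :
    ∃ r : ℝ, R < r ∧ 0 < r ∧ ∀ θ₁ θ₂ : ℝ, θ₁ < θ₂ → θ₂ ≤ θ₁ + 2 * Real.pi →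
      (θ₂ - θ₁) * (c / (2 * Real.exp 2) * (1 + ρ)⁻¹) / (2 * Real.pi) ≤
        relArea r (sector θ₁ θ₂) f := by
  have hpi := Real.pi_pos
  have hne := exists_ne_zero_of_growthOrder hρ hord
  set φ : ℝ → ℝ := fun x => Real.log (maxModulus f (Real.exp x)) with hφ
  have hmono : Monotone φ := log_maxModulus_exp_monotone hf hne
  have hconv : ConvexOn ℝ Set.univ φ := convexOn_log_maxModulus_exp hf hne
  -- Large enough for `ρ + 2 ≤ 3 * N`, yet at most `2 * (1 + ρ)`, which yields the decay `ρ⁻¹` of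
  -- `κ`.
  set N : ℕ := ⌈ρ⌉₊ + 1 with hNdef
  have hN : 0 < N := Nat.succ_pos _
  have hN' : (0 : ℝ) < N := by exact_mod_cast hN
  have hN1 : (1 : ℝ) ≤ N := by exact_mod_cast hN
  have hNρ : ρ + 1 ≤ N := by
    rw [hNdef]; push_cast; linarith [Nat.le_ceil ρ]
  have hNρ' : (N : ℝ) ≤ 2 * (1 + ρ) := by
    rw [hNdef]; push_cast; linarith [Nat.ceil_lt_add_one hρ.le]
  set Δ : ℕ → ℝ := fun k => φ ((k + 1 : ℝ) / N) - φ ((k : ℝ) / N) with hΔdef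
  have hΔ : Monotone Δ := monotone_increments_of_convexOn hconv hN
  obtain ⟨k₀, hk₀⟩ := exists_increment_ge hmono hN hΔ (half_pos hρ)
    (frequently_lt_log_maxModulus_exp hf hρ hord) (max A₀ 1)
  obtain ⟨k₁, hk₁⟩ := exists_nat_ge (N * |R|)
  obtain ⟨m, hm, hmN⟩ := exists_increment_ratio_le (m₀ := max k₀ k₁) hmono hN (by linarith)
    (eventually_log_maxModulus_exp_le hord)
    ((le_max_right _ _).trans (hk₀ _ (le_max_left _ _)))
  have hΔbig : ∀ k, m ≤ k → max A₀ 1 ≤ Δ k := fun k hk =>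
    hk₀ k (((le_max_left _ _).trans hm).trans hk)
  have hcard := le_two_mul_card_ratio_le (Δ := Δ) hΔ (m := m) (N := N)
    (lt_of_lt_of_le one_pos ((le_max_right _ _).trans (hΔbig m le_rfl))) hmN
  set I : Finset ℕ := (Finset.range N).filter fun i => Δ (m + i + 1) ≤ Real.exp 6 * Δ (m + i)
    with hI
  set η : ℝ := 1 / N with hη
  have hη0 : 0 < η := by positivity
  have hη1 : η ≤ 1 := by rw [hη, div_le_one hN']; exact hN1
  set X : ℕ → ℝ := fun i => ((m + i : ℕ) + 1 : ℝ) / N with hX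
  have hex : ∀ i : ℕ, ∃ z : ℂ, i ∈ I → ‖z‖ = Real.exp (X i) ∧
      ∀ θ₁ θ₂ : ℝ, θ₂ ≤ θ₁ + 2 * Real.pi →
        ENNReal.ofReal (c * (θ₂ - θ₁) * (Real.exp (X i) * η) ^ 2) ≤
          volume (f ⁻¹' sector θ₁ θ₂ ∩ Metric.ball z (‖z‖ * η / 4)) := by
    intro i
    by_cases hi : i ∈ I
    · obtain ⟨z, hz⟩ := volume_preimage_sector_disc_ge hloc hf hne (x := X i) (A := Δ (m + i))
        hη0 hη1 ((le_max_left _ _).trans (hΔbig _ (Nat.le_add_right _ _)))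
        (by
          simp only [hΔdef, hφ, hX]
          congr 5
          rw [hη]; push_cast; ring)
        (by
          have h := (Finset.mem_filter.1 hi).2
          refine le_of_eq_of_le ?_ h
          simp only [hΔdef, hφ, hX]
          congr 4
          · rw [hη]; push_cast; ring
          · push_cast; ring)
      exact ⟨z, fun _ => hz⟩
    · exact ⟨0, fun h => absurd h hi⟩
  choose z hz using hex
  -- All centres have modulus between `r / e` and `r e^(-η)`, so the discs fit inside radius `r` and
  -- lose only a factor `e²` in area. This radius is fixed before the sector.
  set r : ℝ := Real.exp ((m + N + 1 : ℝ) / N) with hr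
  have hr0 : 0 < r := Real.exp_pos _
  refine ⟨r, ?_, hr0, ?_⟩
  · have h1 : |R| ≤ (m + N + 1 : ℝ) / N := by
      rw [le_div_iff₀ hN']
      have h2 : (k₁ : ℝ) ≤ m := by exact_mod_cast (le_max_right k₀ k₁).trans hm
      linarith
    have h3 := Real.add_one_le_exp ((m + N + 1 : ℝ) / N)
    linarith [le_abs_self R]
  intro θ₁ θ₂ hθ hθ'
  set W : ℕ → Set ℂ := fun i => f ⁻¹' sector θ₁ θ₂ ∩ Metric.ball (z i) (‖z i‖ * η / 4) with hW
  have hWm : ∀ i ∈ I, MeasurableSet (W i) := fun i _ =>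
    (((isOpen_sector θ₁ θ₂).preimage hf.continuous).inter Metric.isOpen_ball).measurableSet
  have hstep : ∀ i ∈ I, ∀ j ∈ I, i < j → Disjoint (W i) (W j) := by
    intro i hi j hj hij
    refine Set.disjoint_of_subset Set.inter_subset_right Set.inter_subset_right
      (disjoint_ball_of_norm hη0 hη1 ?_)
    rw [(hz i hi).1, (hz j hj).1, ← Real.exp_add, Real.exp_le_exp]
    simp only [hX, hη]
    rw [← add_div]
    gcongr
    have : (i : ℝ) + 1 ≤ j := by exact_mod_cast hij
    push_cast
    linarith
  have hWd : Set.PairwiseDisjoint (I : Set ℕ) W := by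
    intro i hi j hj hij
    rcases lt_or_gt_of_ne hij with h | h
    · exact hstep i hi j hj h
    · exact (hstep j hj i hi h).symm
  have hWsub : (⋃ i ∈ I, W i) ⊆ f ⁻¹' sector θ₁ θ₂ ∩ Metric.ball 0 r := by
    refine Set.iUnion₂_subset fun i hi => Set.inter_subset_inter_right _ ?_
    refine Metric.ball_subset_ball' ?_
    rw [dist_zero_right, (hz i hi).1]
    have hiN : (i : ℝ) + 1 ≤ N := by exact_mod_cast Finset.mem_range.1 (Finset.mem_filter.1 hi).1
    have h1 : Real.exp (X i) * Real.exp η ≤ r := by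
      rw [← Real.exp_add, hr, Real.exp_le_exp]
      simp only [hX, hη]
      rw [← add_div, div_le_div_iff_of_pos_right hN']
      push_cast
      linarith
    have h2 := mul_le_mul_of_nonneg_left (Real.add_one_le_exp η) (Real.exp_pos (X i)).le
    have h3 : 0 < Real.exp (X i) * η := by positivity
    linarith
  have hα : 0 < θ₂ - θ₁ := by linarith
  have hWge : ∀ i ∈ I, ENNReal.ofReal (c * (θ₂ - θ₁) * (r * Real.exp (-1) * η) ^ 2) ≤
      volume (W i) := by
    intro i hi
    refine le_trans (ENNReal.ofReal_le_ofReal ?_) ((hz i hi).2 θ₁ θ₂ hθ')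
    have : r * Real.exp (-1) ≤ Real.exp (X i) := by
      rw [hr, ← Real.exp_add, Real.exp_le_exp]
      have e : (m + N + 1 : ℝ) / N + -1 = (m + 1 : ℝ) / N := by field_simp; ring
      rw [e]
      simp only [hX]
      gcongr
      linarith [(Nat.cast_nonneg i : (0 : ℝ) ≤ i)]
    gcongr
  have hvol : ENNReal.ofReal (I.card * (c * (θ₂ - θ₁) * (r * Real.exp (-1) * η) ^ 2)) ≤
      volume (f ⁻¹' sector θ₁ θ₂ ∩ Metric.ball 0 r) := by
    refine le_trans ?_ (measure_mono hWsub)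
    rw [measure_biUnion_finset hWd hWm, ENNReal.ofReal_mul (by positivity), ENNReal.ofReal_natCast,
      ← nsmul_eq_mul]
    exact Finset.card_nsmul_le_sum _ _ _ hWge
  have hfin : volume (f ⁻¹' sector θ₁ θ₂ ∩ Metric.ball 0 r) ≠ ⊤ :=
    ne_top_of_le_ne_top measure_ball_lt_top.ne (measure_mono Set.inter_subset_right)
  have hreal := (ENNReal.ofReal_le_iff_le_toReal hfin).1 hvol
  have hball : volume.real (Metric.ball (0 : ℂ) r) = Real.pi * r ^ 2 := by
    rw [Measure.real, volume_ball_eq_ofReal _ hr0.le, ENNReal.toReal_ofReal (by positivity)]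
  rw [relArea, hball, le_div_iff₀ (by positivity)]
  refine le_trans ?_ hreal
  have hcard' : (N : ℝ) / 2 ≤ I.card := by
    have : (N : ℝ) ≤ 2 * I.card := by exact_mod_cast hcard
    linarith
  calc (θ₂ - θ₁) * (c / (2 * Real.exp 2) * (1 + ρ)⁻¹) / (2 * Real.pi) * (Real.pi * r ^ 2)
      = (c * (θ₂ - θ₁) * r ^ 2 / (2 * Real.exp 2)) * (1 / (2 * (1 + ρ))) := by
        field_simp
    _ ≤ (c * (θ₂ - θ₁) * r ^ 2 / (2 * Real.exp 2)) * (1 / N) := by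
        gcongr
    _ = N / 2 * (c * (θ₂ - θ₁) * (r * Real.exp (-1) * η) ^ 2) := by
        have : Real.exp (-1) ^ 2 = 1 / Real.exp 2 := by
          rw [← Real.exp_nat_mul, one_div, ← Real.exp_neg]; norm_num
        rw [mul_pow, mul_pow, this, hη]
        field_simp
    _ ≤ I.card * (c * (θ₂ - θ₁) * (r * Real.exp (-1) * η) ^ 2) := by
        gcongr

theorem isEquivalent_const_mul_one_add_inv (c : ℝ) :
    (fun ρ : ℝ => c * (1 + ρ)⁻¹) ~[atTop] fun ρ : ℝ => c * ρ⁻¹ := by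
  refine Asymptotics.IsEquivalent.refl.mul (Asymptotics.IsEquivalent.inv ?_)
  refine (Asymptotics.IsEquivalent.refl (u := fun x : ℝ => x)).const_add_of_norm_tendsto_atTop ?_
  exact tendsto_norm_atTop_atTop

theorem theorem1 :
    ∃ κ : ℝ → ℝ,
      (∀ ρ : ℝ, 0 < ρ → 0 < κ ρ) ∧
      (∃ c : ℝ, 0 < c ∧ κ ~[atTop] (fun ρ : ℝ => c * ρ⁻¹)) ∧
      ∀ ρ : ℝ, 0 < ρ →
        ∀ f : ℂ → ℂ, Differentiable ℂ f → growthOrder f = (ρ : EReal) →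
          ∀ R : ℝ, ∃ r : ℝ, R < r ∧ 0 < r ∧
            ∀ θ₁ θ₂ : ℝ, θ₁ < θ₂ → θ₂ ≤ θ₁ + 2 * Real.pi →
              (θ₂ - θ₁) * κ ρ / (2 * Real.pi) ≤ relArea r (sector θ₁ θ₂) f := by
  obtain ⟨c, hc, A₀, _, hloc⟩ := volume_preimage_sector_unit_disc_ge (Real.exp_pos 6)
  exact ⟨fun ρ => c / (2 * Real.exp 2) * (1 + ρ)⁻¹, fun ρ hρ => by positivity,
    ⟨c / (2 * Real.exp 2), by positivity, isEquivalent_const_mul_one_add_inv _⟩,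
    fun ρ hρ f hf hord R => exists_relArea_sector_ge hc hloc hρ hf hord R⟩
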